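/- Let $1<p<\infty$. Let $L^p=L^p(\mathbb{T})$ on the unit circle $\mathbb{T}$, let $H^p\subset L^p$ be the Hardy space (the functions whose Fourier coefficients of negative index vanish), and let $\mathbb{P}:L^p\to H^p$ be the Riesz projection. For a rational function $\omega$ with complex coefficients, possibly with poles on $\mathbb{T}$, let $T_\omega$ be the (possibly unbounded) operator on $H^p$ given by $$\mathrm{Dom}(T_\omega)=\{g\in H^p : \omega g=f+\rho \text{ with } f\in L^p,\ \rho\in \mathrm{Rat}_0(\mathbb{T})\},\qquad T_\omega g=\mathbb{P}f,$$ where $\mathrm{Rat}_0(\mathbb{T})$ is the space of strictly proper rational functions with all poles on $\mathbb{T}$. Let $\mathbb{D}$ be the open unit disc. Zeroes and poles are the finite ones and are counted with multiplicity. Let $\omega$ be a rational function with at least one pole on $\mathbb{T}$, and let $\kappa$ be the number of zeroes of $\omega$ in $\mathbb{D}$ minus the number of poles of $\omega$ in $\mathbb{D}$. Then $T_\omega$ is invertible, that is, a bijection of $\mathrm{Dom}(T_\omega)$ onto $H^p$, if and only if $\omega$ has no zeroes on $\mathbb{T}$ and $\kappa$ is equal to the number of poles of $\omega$ on $\mathbb{T}$.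 In that case the inverse $T_\omega^{-1}$ is bounded on $H^p$, and $\omega$ factorizes as $$\omega(z)=\omega_-(z)\,\frac{z^\kappa}{q_0(z)}\,\omega_+(z),$$ where $\omega_-$ is a rational function with no poles or zeroes outside $\mathbb{D}$, $\omega_+$ is a rational function with no poles or zeroes in $\overline{\mathbb{D}}$, and $q_0$ is a polynomial of degree $\kappa$ with all its roots on $\mathbb{T}$; moreover, for every such factorization, $$T_\omega^{-1}=T_{\omega_+^{-1}}\,T_{q_0/z^\kappa}\,T_{\omega_-^{-1}}.$$ -/

import Mathlib

open MeasureTheory Filter Topology Polynomial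
open scoped ENNReal

noncomputable section

namespace ToeplitzLike

/-! ### The unit circle and the spaces `L^p`, `H^p`, `K^p` -/

/-- The parametrization `x ↦ exp (2 π i x)` of the unit circle by `ℝ / ℤ`. -/
def zc (x : UnitAddCircle) : ℂ := fourier 1 x

/-- Normalized arc length measure on the unit circle. -/
abbrev arc : Measure UnitAddCircle := AddCircle.haarAddCircle

/-- The space `L^p` of the unit circle. -/
abbrev LpT (p : ℝ≥0∞) := Lp ℂ p arc

lemma integrable_LpT {p : ℝ≥0∞} [Fact (1 ≤ p)] (f : LpT p) : Integrable f arc :=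
  (Lp.memLp f).integrable Fact.out

lemma fourierCoeff_add' {p : ℝ≥0∞} [Fact (1 ≤ p)] (f g : LpT p) (n : ℤ) :
    fourierCoeff (f + g : LpT p) n = fourierCoeff f n + fourierCoeff g n := by
  rw [fourierCoeff_congr_ae (Lp.coeFn_add f g),
    fourierCoeff.add (integrable_LpT f) (integrable_LpT g)]
  rfl

lemma fourierCoeff_smul' {p : ℝ≥0∞} (c : ℂ) (f : LpT p) (n : ℤ) :
    fourierCoeff (c • f : LpT p) n = c * fourierCoeff f n := by
  rw [fourierCoeff_congr_ae (Lp.coeFn_smul c f), fourierCoeff.const_smul]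
  rfl

lemma fourierCoeff_zero' {p : ℝ≥0∞} (n : ℤ) : fourierCoeff (0 : LpT p) n = 0 := by
  simpa using fourierCoeff_smul' (0 : ℂ) (0 : LpT p) n

/-- The Hardy space `H^p`, as the space of boundary functions: the functions in `L^p` all of whose
Fourier coefficients of negative index vanish. -/
def Hardy (p : ℝ≥0∞) [Fact (1 ≤ p)] : Submodule ℂ (LpT p) where
  carrier := {f | ∀ n : ℤ, n < 0 → fourierCoeff f n = 0}
  zero_mem' := fun n _ => fourierCoeff_zero' n
  add_mem' := fun {f g} hf hg n hn => by rw [fourierCoeff_add', hf n hn, hg n hn, add_zero]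
  smul_mem' := fun c f hf n hn => by rw [fourierCoeff_smul', hf n hn, mul_zero]

/-- The standard complement `K^p` of `H^p` in `L^p`: the functions in `L^p` all of whose
Fourier coefficients of nonnegative index vanish. -/
def coHardy (p : ℝ≥0∞) [Fact (1 ≤ p)] : Submodule ℂ (LpT p) where
  carrier := {f | ∀ n : ℤ, 0 ≤ n → fourierCoeff f n = 0}
  zero_mem' := fun n _ => fourierCoeff_zero' n
  add_mem' := fun {f g} hf hg n hn => by rw [fourierCoeff_add', hf n hn, hg n hn, add_zero]
  smul_mem' := fun c f hf n hn => by rw [fourierCoeff_smul', hf n hn, mul_zero]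

/-- An integrable function with vanishing Fourier coefficients vanishes almost everywhere. -/
lemma ae_eq_zero_of_fourierCoeff {f : UnitAddCircle → ℂ} (hf : Integrable f arc)
    (h : ∀ n, fourierCoeff f n = 0) : f =ᵐ[arc] 0 := by
  have hint : ∀ g : C(UnitAddCircle, ℂ), Integrable (fun x => g x * f x) arc := fun g =>
    hf.bdd_mul g.continuous.aestronglyMeasurable (Eventually.of_forall fun x => g.norm_coe_le_norm x)
  have key : ∀ g : C(UnitAddCircle, ℂ), ∫ x, g x * f x ∂arc = 0 := by
    have hcont : Continuous (fun g : C(UnitAddCircle, ℂ) => ∫ x, g x * f x ∂arc) := by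
      have hl : LipschitzWith (Real.toNNReal (∫ x, ‖f x‖ ∂arc))
          (fun g : C(UnitAddCircle, ℂ) => ∫ x, g x * f x ∂arc) := by
        refine LipschitzWith.of_dist_le_mul fun g g' => ?_
        rw [dist_eq_norm, dist_eq_norm, ← integral_sub (hint g) (hint g'),
          Real.coe_toNNReal _ (integral_nonneg fun _ => norm_nonneg _), mul_comm,
          ← integral_const_mul]
        refine norm_integral_le_of_norm_le (hf.norm.const_mul _)
          (Eventually.of_forall fun x => ?_)
        rw [← sub_mul, norm_mul]
        exact mul_le_mul_of_nonneg_right ((g - g').norm_coe_le_norm x) (norm_nonneg _)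
      exact hl.continuous
    have hcl : IsClosed {g : C(UnitAddCircle, ℂ) | ∫ x, g x * f x ∂arc = 0} :=
      isClosed_eq hcont continuous_const
    have hspan : (Submodule.span ℂ (Set.range (@fourier (1 : ℝ))) : Set C(UnitAddCircle, ℂ)) ⊆
        {g : C(UnitAddCircle, ℂ) | ∫ x, g x * f x ∂arc = 0} := by
      intro g hg
      induction hg using Submodule.span_induction with
      | mem g hg =>
        obtain ⟨n, rfl⟩ := hg
        have := h (-n)
        simpa [fourierCoeff, -fourier_apply] using this
      | zero => simp
      | add g g' _ _ h1 h2 =>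
        have e : (fun x => (g + g') x * f x) = fun x => g x * f x + g' x * f x := by
          ext x; simp [add_mul]
        simp only [Set.mem_ofPred_eq] at h1 h2 ⊢
        rw [e, integral_add (hint g) (hint g'), h1, h2, add_zero]
      | smul c g _ h1 =>
        simp only [Set.mem_ofPred_eq] at h1 ⊢
        have e : (fun x => (c • g) x * f x) = fun x => c * (g x * f x) := by
          ext x; simp [mul_assoc]
        rw [e, integral_const_mul, h1, mul_zero]
    intro g
    have hg : g ∈ (Submodule.span ℂ (Set.range (@fourier (1 : ℝ)))).topologicalClosure := by
      rw [span_fourier_closure_eq_top]; trivial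
    exact closure_minimal hspan hcl hg
  refine ae_eq_zero_of_forall_setIntegral_isClosed_eq_zero hf fun s hs => ?_
  have hlim : Tendsto (fun n => ∫ x, ((hs.apprSeq n x : NNReal) : ℂ) * f x ∂arc) atTop
      (𝓝 (∫ x, s.indicator f x ∂arc)) := by
    refine tendsto_integral_of_dominated_convergence (fun x => ‖f x‖) (fun n => ?_) hf.norm
      (fun n => ?_) ?_
    · exact (Complex.continuous_ofReal.comp (NNReal.continuous_coe.comp
        (hs.apprSeq n).continuous)).aestronglyMeasurable.mul hf.aestronglyMeasurable
    · refine Eventually.of_forall fun x => ?_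
      rw [norm_mul]
      have h1 : ‖((hs.apprSeq n x : NNReal) : ℂ)‖ ≤ 1 := by
        simpa using HasOuterApproxClosed.apprSeq_apply_le_one hs n x
      exact mul_le_of_le_one_left (norm_nonneg _) h1
    · refine Eventually.of_forall fun x => ?_
      have h1 := (tendsto_pi_nhds.1 (HasOuterApproxClosed.tendsto_apprSeq hs)) x
      have h2 : Tendsto (fun n => ((hs.apprSeq n x : NNReal) : ℂ)) atTop
          (𝓝 (((s.indicator (fun _ => (1 : NNReal)) x : NNReal) : ℝ) : ℂ)) :=
        ((Complex.continuous_ofReal.comp NNReal.continuous_coe).tendsto _).comp h1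
      have h3 := h2.mul_const (f x)
      convert h3 using 2
      by_cases hx : x ∈ s <;> simp [hx]
  have hz : ∀ n, ∫ x, ((hs.apprSeq n x : NNReal) : ℂ) * f x ∂arc = 0 := fun n =>
    key ⟨fun x => ((hs.apprSeq n x : NNReal) : ℂ),
      Complex.continuous_ofReal.comp (NNReal.continuous_coe.comp (hs.apprSeq n).continuous)⟩
  simp only [hz] at hlim
  rw [← integral_indicator hs.measurableSet]
  exact (tendsto_nhds_unique hlim tendsto_const_nhds)

lemma disjoint_hardy (p : ℝ≥0∞) [Fact (1 ≤ p)] : Disjoint (Hardy p) (coHardy p) := by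
  rw [Submodule.disjoint_def]
  intro f hf hk
  rw [Lp.eq_zero_iff_ae_eq_zero]
  refine ae_eq_zero_of_fourierCoeff (integrable_LpT f) fun n => ?_
  rcases lt_or_ge n 0 with hn | hn
  exacts [hf n hn, hk n hn]

lemma exists_rieszProj (p : ℝ≥0∞) [Fact (1 ≤ p)] : ∃ P : LpT p →ₗ[ℂ] Hardy p,
    (∀ h : Hardy p, P h = h) ∧ ∀ k ∈ coHardy p, P k = 0 := by
  obtain ⟨r, hr⟩ := LinearMap.exists_leftInverse_of_injective
    ((coHardy p).mkQ ∘ₗ (Hardy p).subtype) (by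
      rw [LinearMap.ker_eq_bot']
      intro h hh
      have : (h : LpT p) ∈ coHardy p := by simpa using hh
      exact Subtype.ext ((Submodule.disjoint_def.1 (disjoint_hardy p)) _ h.2 this))
  refine ⟨r ∘ₗ (coHardy p).mkQ, fun h => by simpa using congr($hr h), fun k hk => ?_⟩
  simp [(Submodule.Quotient.mk_eq_zero _).2 hk]

/-- The Riesz projection of `L^p` onto `H^p`: the linear map which is the identity on `H^p` and
zero on `K^p`. For `1 < p < ∞` one has `L^p = H^p ⊕ K^p` (M. Riesz), so that these two properties
determine it. -/
def rieszProj (p : ℝ≥0∞) [Fact (1 ≤ p)] : LpT p →ₗ[ℂ] Hardy p :=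
  (exists_rieszProj p).choose

lemma rieszProj_hardy {p : ℝ≥0∞} [Fact (1 ≤ p)] (h : Hardy p) : rieszProj p h = h :=
  (exists_rieszProj p).choose_spec.1 h

lemma rieszProj_coHardy {p : ℝ≥0∞} [Fact (1 ≤ p)] {k : LpT p} (hk : k ∈ coHardy p) :
    rieszProj p k = 0 :=
  (exists_rieszProj p).choose_spec.2 k hk

/-! ### Rational functions, their zeroes and poles -/

/-- The boundary function on the circle of a rational function (defined off its poles). -/
def onCircle (ω : RatFunc ℂ) (x : UnitAddCircle) : ℂ := ω.eval (RingHom.id ℂ) (zc x)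

/-- `z` is a (finite) zero of `ω`. -/
def IsZeroOf (ω : RatFunc ℂ) (z : ℂ) : Prop := ω.num.IsRoot z

/-- `z` is a (finite) pole of `ω`. -/
def IsPoleOf (ω : RatFunc ℂ) (z : ℂ) : Prop := ω.denom.IsRoot z

open Classical in
/-- The number of zeroes of `ω` in `S`, multiplicities taken into account. -/
def numZeroes (ω : RatFunc ℂ) (S : Set ℂ) : ℕ := (ω.num.roots.filter (· ∈ S)).card

open Classical in
/-- The number of poles of `ω` in `S`, multiplicities taken into account. -/
def numPoles (ω : RatFunc ℂ) (S : Set ℂ) : ℕ := (ω.denom.roots.filter (· ∈ S)).card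

/-- The open unit disc. -/
def disc : Set ℂ := {z | ‖z‖ < 1}

/-- The unit circle, as a subset of the plane. -/
def circ : Set ℂ := {z | ‖z‖ = 1}

lemma zc_mem_circ (x : UnitAddCircle) : zc x ∈ circ := by
  simpa [zc, circ] using Circle.norm_coe (AddCircle.toCircle x)

instance : NullSingletonClass arc := by
  have : Nontrivial UnitAddCircle := by
    refine ⟨⟨((1 / 2 : ℝ) : UnitAddCircle), 0, fun h => ?_⟩⟩
    obtain ⟨n, hn⟩ := (AddCircle.coe_eq_zero_iff (1 : ℝ)).1 h
    have h2 : ((2 * n : ℤ) : ℝ) = ((1 : ℤ) : ℝ) := by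
      push_cast
      simp at hn
      linarith
    have h3 : 2 * n = 1 := by exact_mod_cast h2
    omega
  infer_instance

lemma finite_eval_eq_zero {q : ℂ[X]} (hq : q ≠ 0) :
    {x : UnitAddCircle | q.eval (zc x) = 0}.Finite := by
  have hinj : Function.Injective zc := by
    intro x y hxy
    have : (AddCircle.toCircle x : ℂ) = AddCircle.toCircle y := by simpa [zc] using hxy
    exact AddCircle.injective_toCircle one_ne_zero (Subtype.ext this)
  refine Set.Finite.of_finite_image (f := zc) (q.roots.toFinset.finite_toSet.subset ?_)
    hinj.injOn
  rintro _ ⟨x, hx, rfl⟩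
  simpa [hq] using hx

lemma ae_eval_ne_zero {q : ℂ[X]} (hq : q ≠ 0) : ∀ᵐ x ∂arc, q.eval (zc x) ≠ 0 := by
  have hfin := finite_eval_eq_zero hq
  rw [ae_iff]
  simpa using hfin.measure_zero arc

lemma onCircle_eq (ω : RatFunc ℂ) (x : UnitAddCircle) :
    onCircle ω x = ω.num.eval (zc x) / ω.denom.eval (zc x) := by
  simp [onCircle, RatFunc.eval, Polynomial.eval₂_id]

lemma onCircle_add (ω ψ : RatFunc ℂ) :
    ∀ᵐ x ∂arc, onCircle (ω + ψ) x = onCircle ω x + onCircle ψ x := by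
  filter_upwards [ae_eval_ne_zero ω.denom_ne_zero, ae_eval_ne_zero ψ.denom_ne_zero] with x h1 h2
  exact RatFunc.eval_add (f := RingHom.id ℂ) (a := zc x)
    (by rwa [Polynomial.eval₂_id]) (by rwa [Polynomial.eval₂_id])

lemma onCircle_smul (c : ℂ) (ω : RatFunc ℂ) :
    ∀ᵐ x ∂arc, onCircle (c • ω) x = c * onCircle ω x := by
  filter_upwards [ae_eval_ne_zero ω.denom_ne_zero] with x h1
  rw [RatFunc.smul_eq_C_mul, onCircle, RatFunc.eval_mul (f := RingHom.id ℂ) (a := zc x)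
    (by simp) (by rwa [Polynomial.eval₂_id]), RatFunc.eval_C]
  rfl

lemma ratZero_aux {ρ : RatFunc ℂ} {a b : ℂ[X]} (h : ρ.num * b = a * ρ.denom)
    (hdeg : a.degree < b.degree) (hroots : ∀ z, b.IsRoot z → z ∈ circ) :
    ρ.num.degree < ρ.denom.degree ∧ ∀ z, IsPoleOf ρ z → z ∈ circ := by
  constructor
  · by_contra hcon
    have hd := Polynomial.degree_ne_bot.2 ρ.denom_ne_zero
    have h1 : a.degree + ρ.denom.degree < b.degree + ρ.denom.degree :=
      WithBot.add_lt_add_right hd hdeg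
    have h2 := congrArg Polynomial.degree h
    rw [degree_mul, degree_mul] at h2
    rw [← h2, add_comm] at h1
    exact absurd h1 (not_lt.2 (add_le_add_right (not_lt.1 hcon) _))
  · intro z hz
    refine hroots z (Polynomial.IsRoot.dvd hz ?_)
    exact ρ.isCoprime_num_denom.symm.dvd_of_dvd_mul_left (Dvd.intro_left a h.symm)

/-- Strictly proper rational functions all of whose poles lie on the unit circle. -/
def RatZeroT : Submodule ℂ (RatFunc ℂ) where
  carrier := {ρ | ρ.num.degree < ρ.denom.degree ∧ ∀ z, IsPoleOf ρ z → z ∈ circ}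
  zero_mem' := by simp [IsPoleOf]
  add_mem' := by
    rintro ρ σ ⟨h1, h2⟩ ⟨h3, h4⟩
    refine ratZero_aux (RatFunc.num_denom_add ρ σ) ?_ fun z hz => ?_
    · refine (Polynomial.degree_add_le _ _).trans_lt (max_lt ?_ ?_)
      · rw [degree_mul, degree_mul]
        exact WithBot.add_lt_add_right (Polynomial.degree_ne_bot.2 σ.denom_ne_zero) h1
      · rw [degree_mul, degree_mul]
        exact WithBot.add_lt_add_left (Polynomial.degree_ne_bot.2 ρ.denom_ne_zero) h3
    · rcases Polynomial.root_mul.1 hz with h | h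
      exacts [h2 z h, h4 z h]
  smul_mem' := by
    rintro c ρ ⟨h1, h2⟩
    refine ratZero_aux (a := Polynomial.C c * ρ.num) ?_ ?_ h2
    · rw [RatFunc.num_mul_eq_mul_denom_iff ρ.denom_ne_zero, RatFunc.smul_eq_C_mul, map_mul,
        mul_div_assoc, RatFunc.num_div_denom]
      rfl
    · rw [degree_mul]
      refine lt_of_le_of_lt ?_ h1
      exact (add_le_add_left Polynomial.degree_C_le _).trans (by simp)

lemma not_integrable_onCircle {ρ : RatFunc ℂ} {α : ℂ} (hα : α ∈ circ) (hpole : IsPoleOf ρ α) :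
    ¬ Integrable (onCircle ρ) arc := by
  intro hint
  obtain ⟨a, rfl⟩ : ∃ a : ℝ, zc (a : UnitAddCircle) = α := by
    have h1 : ‖α‖ = 1 := hα
    refine ⟨α.arg / (2 * Real.pi), ?_⟩
    rw [zc, fourier_coe_apply]
    conv_rhs => rw [← Complex.norm_mul_exp_arg_mul_I α, h1]
    have : (Real.pi : ℂ) ≠ 0 := by exact_mod_cast Real.pi_ne_zero
    push_cast
    rw [one_mul]
    congr 1
    field_simp
  have hvol : Integrable (onCircle ρ) (volume : Measure UnitAddCircle) := by
    simpa [AddCircle.volume_eq_smul_haarAddCircle] using hint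
  have hI : IntervalIntegrable (fun t : ℝ => onCircle ρ (t : UnitAddCircle)) volume a (a + 1) := by
    rw [intervalIntegrable_iff_integrableOn_Ioc_of_le (by linarith)]
    exact (AddCircle.measurePreserving_mk (1 : ℝ) a).integrable_comp_of_integrable hvol
  refine not_intervalIntegrable_of_sub_inv_isBigO_punctured (c := a) ?_ (by simp) (by simp) hI
  have hnum : ρ.num.eval (zc a) ≠ 0 := by
    intro h0
    obtain ⟨u, v, huv⟩ := ρ.isCoprime_num_denom
    have := congrArg (Polynomial.eval (zc a)) huv
    have hp : ρ.denom.eval (zc a) = 0 := hpole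
    simp [h0, hp] at this
  have hzd : DifferentiableAt ℝ (fun t : ℝ => zc (t : UnitAddCircle)) a :=
    (hasDerivAt_fourier (T := (1 : ℝ)) 1 a).differentiableAt
  have hpd : ∀ q : ℂ[X], DifferentiableAt ℝ (fun t : ℝ => q.eval (zc (t : UnitAddCircle))) a :=
    fun q => (q.differentiable.restrictScalars ℝ _).comp a hzd
  have hd : DifferentiableAt ℝ (fun t : ℝ => ρ.denom.eval (zc (t : UnitAddCircle)) /
      ρ.num.eval (zc (t : UnitAddCircle))) a := (hpd _).div (hpd _) hnum
  have hO := hd.isBigO_sub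
  have hp : ρ.denom.eval (zc a) = 0 := hpole
  simp only [hp, zero_div, sub_zero] at hO
  have hO' := (hO.mono (nhdsWithin_le_nhds (s := {a}ᶜ))).inv_rev ?_
  · refine hO'.congr_right fun t => ?_
    rw [onCircle_eq, inv_div]
  · have hI : Set.Ico (a - 1 / 2) (a - 1 / 2 + 1) ∈ 𝓝 a :=
      Ico_mem_nhds (by linarith) (by linarith)
    have hfin : ({t : ℝ | ρ.denom.eval (zc (t : UnitAddCircle)) = 0} ∩
        Set.Ico (a - 1 / 2) (a - 1 / 2 + 1)).Finite := by
      refine Set.Finite.of_finite_image (f := fun t : ℝ => (t : UnitAddCircle))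
        ((finite_eval_eq_zero ρ.denom_ne_zero).subset ?_) ?_
      · rintro _ ⟨t, ⟨ht, -⟩, rfl⟩
        exact ht
      · intro s hs t ht hst
        exact (AddCircle.coe_eq_coe_iff_of_mem_Ico hs.2 ht.2).1 hst
    have hmem := (hfin.subset (Set.sdiff_subset (t := {a}))).isClosed.isOpen_compl.mem_nhds
      (show a ∈ _ by simp)
    have hn := (hpd ρ.num).continuousAt.eventually_ne hnum
    filter_upwards [nhdsWithin_le_nhds hI, nhdsWithin_le_nhds hmem, self_mem_nhdsWithin,
      nhdsWithin_le_nhds hn] with t h1 h2 h3 h4 h5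
    exact absurd ⟨⟨(div_eq_zero_iff.1 h5).resolve_right h4, h1⟩, h3⟩ h2

/-- A strictly proper rational function with all poles on the circle that lies in `L^p` is zero. -/
lemma eq_zero_of_mem_Lp {p : ℝ≥0∞} [Fact (1 ≤ p)] {ρ : RatFunc ℂ} (hρ : ρ ∈ RatZeroT) (f : LpT p)
    (h : ∀ᵐ x ∂arc, f x = onCircle ρ x) : ρ = 0 := by
  by_contra h0
  have hdeg : 0 < ρ.denom.degree := by
    refine lt_of_le_of_lt ?_ hρ.1
    exact Polynomial.zero_le_degree_iff.2 (RatFunc.num_ne_zero h0)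
  obtain ⟨α, hα⟩ := Complex.exists_root hdeg
  exact not_integrable_onCircle (hρ.2 α hα) hα ((integrable_LpT f).congr h)

/-! ### The Toeplitz-like operator -/

/-- The graph of `T_ω`: the pairs `(g, ℙ f)` with `g ∈ H^p`, `f ∈ L^p` and `ω g = f + ρ` on the
circle for some strictly proper rational `ρ` with all its poles on the circle. -/
def toeplitzGraph (p : ℝ≥0∞) [Fact (1 ≤ p)] (ω : RatFunc ℂ) :
    Submodule ℂ (Hardy p × Hardy p) where
  carrier := {u | ∃ f : LpT p, ∃ ρ ∈ RatZeroT,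
    (∀ᵐ x ∂arc, onCircle ω x * (u.1 : LpT p) x = f x + onCircle ρ x) ∧ u.2 = rieszProj p f}
  zero_mem' := by
    refine ⟨0, 0, RatZeroT.zero_mem, ?_, by simp⟩
    filter_upwards [Lp.coeFn_zero ℂ p arc] with x hx
    simp [onCircle]
  add_mem' := by
    rintro u v ⟨f, ρ, hρ, h1, h2⟩ ⟨f', ρ', hρ', h1', h2'⟩
    refine ⟨f + f', ρ + ρ', RatZeroT.add_mem hρ hρ', ?_, by simp [h2, h2']⟩
    filter_upwards [h1, h1', Lp.coeFn_add f f', Lp.coeFn_add (u.1 : LpT p) (v.1 : LpT p),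
      onCircle_add ρ ρ'] with x a1 a2 a3 a4 a5
    simp only [Prod.fst_add, Submodule.coe_add, a4, a3, a5, Pi.add_apply, mul_add, a1, a2]
    ring
  smul_mem' := by
    rintro c u ⟨f, ρ, hρ, h1, h2⟩
    refine ⟨c • f, c • ρ, RatZeroT.smul_mem c hρ, ?_, by simp [h2]⟩
    filter_upwards [h1, Lp.coeFn_smul c f, Lp.coeFn_smul c (u.1 : LpT p),
      onCircle_smul c ρ] with x a1 a2 a3 a4
    simp only [Prod.smul_fst, Submodule.coe_smul, a2, a3, a4, Pi.smul_apply, smul_eq_mul]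
    linear_combination c * a1

lemma toeplitzGraph_wellDefined (p : ℝ≥0∞) [Fact (1 ≤ p)] (ω : RatFunc ℂ)
    (u : Hardy p × Hardy p) (hu : u ∈ toeplitzGraph p ω) (h0 : u.1 = 0) : u.2 = 0 := by
  obtain ⟨f, ρ, hρ, h1, h2⟩ := hu
  have hz : ∀ᵐ x ∂arc, f x = onCircle (-ρ) x := by
    rw [h0] at h1
    have e : (-ρ) = (-1 : ℂ) • ρ := by simp
    rw [e]
    filter_upwards [h1, Lp.coeFn_zero ℂ p arc, onCircle_smul (-1) ρ] with x a1 a2 a3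
    rw [Submodule.coe_zero, a2] at a1
    rw [a3]
    simp only [Pi.zero_apply, mul_zero] at a1
    linear_combination -a1
  have hρ0 := eq_zero_of_mem_Lp (RatZeroT.neg_mem hρ) f hz
  have hf0 : f = 0 := by
    rw [Lp.eq_zero_iff_ae_eq_zero]
    filter_upwards [hz] with x hx
    rw [hx, hρ0]
    simp [onCircle]
  rw [h2, hf0, map_zero]

/-- The Toeplitz-like operator `T_ω` on `H^p`, with domain the `g ∈ H^p` such that
`ω g = f + ρ` with `f ∈ L^p` and `ρ` strictly proper with all its poles on the circle, and
`T_ω g = ℙ f`. -/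
def toeplitz (p : ℝ≥0∞) [Fact (1 ≤ p)] (ω : RatFunc ℂ) : Hardy p →ₗ.[ℂ] Hardy p :=
  (toeplitzGraph p ω).toLinearPMap

lemma mem_toeplitz_domain {p : ℝ≥0∞} [Fact (1 ≤ p)] {ω : RatFunc ℂ} {g : Hardy p} :
    g ∈ (toeplitz p ω).domain ↔ ∃ f : LpT p, ∃ ρ ∈ RatZeroT,
      ∀ᵐ x ∂arc, onCircle ω x * (g : LpT p) x = f x + onCircle ρ x := by
  constructor
  · rintro ⟨u, ⟨f, ρ, hρ, h1, -⟩, rfl⟩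
    exact ⟨f, ρ, hρ, h1⟩
  · rintro ⟨f, ρ, hρ, h1⟩
    exact ⟨(g, rieszProj p f), ⟨f, ρ, hρ, h1, rfl⟩, rfl⟩

lemma toeplitz_apply {p : ℝ≥0∞} [Fact (1 ≤ p)] {ω : RatFunc ℂ} (g : (toeplitz p ω).domain)
    {f : LpT p} {ρ : RatFunc ℂ} (hρ : ρ ∈ RatZeroT)
    (h : ∀ᵐ x ∂arc, onCircle ω x * ((g : Hardy p) : LpT p) x = f x + onCircle ρ x) :
    toeplitz p ω g = rieszProj p f := by
  have h1 : ((g : Hardy p), toeplitz p ω g) ∈ toeplitzGraph p ω :=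
    Submodule.mem_graph_toLinearPMap (toeplitzGraph_wellDefined p ω) g
  have h2 : ((g : Hardy p), rieszProj p f) ∈ toeplitzGraph p ω := ⟨f, ρ, hρ, h, rfl⟩
  have h3 := toeplitzGraph_wellDefined p ω _ ((toeplitzGraph p ω).sub_mem h1 h2) (by simp)
  simpa [sub_eq_zero] using h3

/-! ### Composition of partially defined operators -/

/-- The composition `B A` of partially defined operators, with its natural domain
`{x ∈ Dom A | A x ∈ Dom B}`. -/
def pcomp {E : Type*} [AddCommGroup E] [Module ℂ E] (B A : E →ₗ.[ℂ] E) : E →ₗ.[ℂ] E :=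
  B.comp (A.domRestrict ((B.domain.comap A.toFun).map A.domain.subtype)) (by
    rintro ⟨x, hx⟩
    obtain ⟨⟨y, hy, hyx⟩, hxA⟩ := hx
    have e : y = ⟨x, hxA⟩ := Subtype.ext hyx
    subst e
    exact hy)

lemma mem_pcomp_domain {E : Type*} [AddCommGroup E] [Module ℂ E] {B A : E →ₗ.[ℂ] E} {x : E} :
    x ∈ (pcomp B A).domain ↔ ∃ h : x ∈ A.domain, A ⟨x, h⟩ ∈ B.domain := by
  constructor
  · rintro ⟨⟨y, hy, rfl⟩, hxA⟩
    exact ⟨hxA, hy⟩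
  · rintro ⟨h, hB⟩
    exact ⟨⟨⟨x, h⟩, hB, rfl⟩, h⟩

/-! ### The factorization -/

/-- `ω = ω₋ (z^κ / q₀) ω₊`, where `ω₋` has no poles or zeroes outside the open disc, `ω₊` has none
in the closed disc, and `q₀` is a polynomial of degree `κ` with all its roots on the circle. -/
structure IsFactorization (ω : RatFunc ℂ) (κ : ℤ) (ωm : RatFunc ℂ) (q0 : ℂ[X])
    (ωp : RatFunc ℂ) : Prop where
  eq : ω = ωm * (RatFunc.X ^ κ / algebraMap ℂ[X] (RatFunc ℂ) q0) * ωp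
  minus : ∀ z : ℂ, 1 ≤ ‖z‖ → ¬ IsZeroOf ωm z ∧ ¬ IsPoleOf ωm z
  plus : ∀ z : ℂ, ‖z‖ ≤ 1 → ¬ IsZeroOf ωp z ∧ ¬ IsPoleOf ωp z
  ne_zero : q0 ≠ 0
  degree : (q0.natDegree : ℤ) = κ
  roots : ∀ z : ℂ, q0.IsRoot z → z ∈ circ

end ToeplitzLike

end

noncomputable section

namespace ToeplitzLike

variable {p : ℝ≥0∞}

/-! ### The action of polynomials on `L^p` -/

/-! The operator reduces to division of `H^p` functions by polynomials. Write `ω = N / (d e)`, with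
the roots of `d` in the closed disc and those of `e` outside it. Then `T_ω g = h` exactly when `N g
= d e h + e r` for some polynomial `r` with `deg r < deg d` (`mem_toeplitzGraph_iff`). Indeed this
equation says `ω g = h + r / d`, and partial fractions split `r / d` into a part with poles in the
disc, which lies in `K^p` and is killed by the projection, and a part in `Rat₀(𝕋)`.

Polynomials without roots in the closed disc are invertible on `H^p`. A polynomial `a` with all
roots in the disc allows division with a unique remainder of degree below `deg a`
(`exists_hardy_div`, `eq_zero_of_poly_smul_eq_poly`). So if `N = a c`, with the roots of `a` in the
disc and those of `c` outside the closed disc, the equation is uniquely solvable for every `h` when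
`deg a = deg d`. If `deg d` is larger there is a kernel; if `deg a` is larger the constant `1` is
not in the range. Since `deg d` counts the poles in the closed disc, equality of degrees is the
condition on `κ`.

A zero `α` of `ω` on the circle prevents surjectivity: otherwise every `h` in `H^p` would be `(z -
α) g + c`, and by the open mapping theorem the value `c` at `α` would be continuous in the `L^p`
norm (`not_surjective_mulAddConst`).

The graph is closed, being the preimage of a finite-dimensional space, so the inverse is bounded.
Given a factorization, counting roots in the disc shows that numerator and denominator of `ω₋` have
equal degree. The remainders of the three successive divisions then add up to one admissible
remainder for `ω`, which gives the formula for the inverse. -/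

lemma norm_zc (x : UnitAddCircle) : ‖zc x‖ = 1 := zc_mem_circ x

lemma continuous_zc : Continuous zc := (fourier 1).continuous

lemma continuous_eval_zc (q : ℂ[X]) : Continuous fun x => q.eval (zc x) :=
  q.continuous.comp continuous_zc

lemma memLp_mul_of_bound {φ : UnitAddCircle → ℂ} (hφ : AEStronglyMeasurable φ arc) {C : ℝ}
    (hC : ∀ x, ‖φ x‖ ≤ C) (f : LpT p) : MemLp (fun x => φ x * f x) p arc :=
  (Lp.memLp f).of_le_mul (c := C) (hφ.mul (Lp.aestronglyMeasurable f))
    (Eventually.of_forall fun x => by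
      rw [norm_mul]; exact mul_le_mul_of_nonneg_right (hC x) (norm_nonneg _))

/-- The constant function `1`. -/
def oneLp : LpT p := MemLp.toLp (fun _ => (1 : ℂ)) (memLp_const 1)

lemma coeFn_oneLp : ∀ᵐ x ∂arc, (oneLp : LpT p) x = 1 := MemLp.coeFn_toLp (memLp_const 1)

lemma fourierCoeff_oneLp (n : ℤ) :
    fourierCoeff (oneLp : LpT p) n = if n = 0 then 1 else 0 := by
  have h : (oneLp : LpT p) =ᵐ[arc] fun x => fourier 0 x := by
    filter_upwards [coeFn_oneLp (p := p)] with x hx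
    rw [hx, fourier_zero]
  rw [fourierCoeff_congr_ae h]
  have := congrFun (fourierCoeff_fourier (T := 1) 0) n
  rw [this, Pi.single_apply]

variable [Fact (1 ≤ p)]

/-- Multiplication by the coordinate function. -/
def shift : LpT p →L[ℂ] LpT p :=
  LinearMap.mkContinuous
    { toFun := fun f => (memLp_mul_of_bound continuous_zc.aestronglyMeasurable
        (fun x => (norm_zc x).le) f).toLp
      map_add' := fun f g => by
        refine Lp.ext ?_
        filter_upwards [MemLp.coeFn_toLp (memLp_mul_of_bound
            continuous_zc.aestronglyMeasurable (fun x => (norm_zc x).le) (f + g)),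
          MemLp.coeFn_toLp (memLp_mul_of_bound
            continuous_zc.aestronglyMeasurable (fun x => (norm_zc x).le) f),
          MemLp.coeFn_toLp (memLp_mul_of_bound
            continuous_zc.aestronglyMeasurable (fun x => (norm_zc x).le) g),
          Lp.coeFn_add f g, Lp.coeFn_add (MemLp.toLp _ (memLp_mul_of_bound
            continuous_zc.aestronglyMeasurable (fun x => (norm_zc x).le) f))
            (MemLp.toLp _ (memLp_mul_of_bound
            continuous_zc.aestronglyMeasurable (fun x => (norm_zc x).le) g))] with x h1 h2 h3 h4 h5
        rw [h1, h5, Pi.add_apply, h2, h3, h4, Pi.add_apply, mul_add]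
      map_smul' := fun c f => by
        refine Lp.ext ?_
        filter_upwards [MemLp.coeFn_toLp (memLp_mul_of_bound
            continuous_zc.aestronglyMeasurable (fun x => (norm_zc x).le) (c • f)),
          MemLp.coeFn_toLp (memLp_mul_of_bound
            continuous_zc.aestronglyMeasurable (fun x => (norm_zc x).le) f),
          Lp.coeFn_smul c f, Lp.coeFn_smul c (MemLp.toLp _ (memLp_mul_of_bound
            continuous_zc.aestronglyMeasurable (fun x => (norm_zc x).le) f))] with x h1 h2 h3 h4
        rw [h1, RingHom.id_apply, h4, Pi.smul_apply, h2, h3, Pi.smul_apply, smul_eq_mul,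
          smul_eq_mul]
        ring } 1 (fun f => by
    rw [one_mul]
    refine Lp.norm_le_norm_of_ae_le ?_
    filter_upwards [MemLp.coeFn_toLp (memLp_mul_of_bound
      continuous_zc.aestronglyMeasurable (fun x => (norm_zc x).le) f)] with x h1
    simp only [LinearMap.coe_mk, AddHom.coe_mk]
    rw [h1, norm_mul, norm_zc, one_mul])

lemma coeFn_shift (f : LpT p) : ∀ᵐ x ∂arc, shift f x = zc x * f x :=
  MemLp.coeFn_toLp (memLp_mul_of_bound
    continuous_zc.aestronglyMeasurable (fun x => (norm_zc x).le) f)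

/-- Polynomials act on `L^p` by multiplication with their restriction to the circle. -/
instance polyModule : Module ℂ[X] (LpT p) :=
  Module.compHom (LpT p) (aeval (R := ℂ) (shift (p := p))).toRingHom

lemma poly_smul_def (q : ℂ[X]) (f : LpT p) : q • f = aeval (R := ℂ) (shift (p := p)) q f := rfl

instance : IsScalarTower ℂ ℂ[X] (LpT p) where
  smul_assoc c q f := by simp [poly_smul_def]

lemma C_smul (c : ℂ) (f : LpT p) : (C c : ℂ[X]) • f = c • f := by
  simp [poly_smul_def, Algebra.algebraMap_eq_smul_one]

lemma X_smul (f : LpT p) : (X : ℂ[X]) • f = shift f := by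
  simp [poly_smul_def]

lemma continuous_poly_smul (q : ℂ[X]) : Continuous fun f : LpT p => q • f :=
  (aeval (R := ℂ) (shift (p := p)) q).continuous

lemma coeFn_poly_smul (q : ℂ[X]) (f : LpT p) :
    ∀ᵐ x ∂arc, (q • f : LpT p) x = q.eval (zc x) * f x := by
  induction q using Polynomial.induction_on' with
  | add q r hq hr =>
    rw [add_smul]
    filter_upwards [hq, hr, Lp.coeFn_add (q • f) (r • f)] with x h1 h2 h3
    rw [h3, Pi.add_apply, h1, h2, eval_add, add_mul]
  | monomial n a =>
    induction n with
    | zero =>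
      rw [monomial_zero_left, C_smul]
      filter_upwards [Lp.coeFn_smul a f] with x h1
      simpa using h1
    | succ n ih =>
      have e : monomial (n + 1) a = X * monomial n a := by
        rw [X_mul_monomial]
      rw [e, mul_smul, X_smul]
      filter_upwards [ih, coeFn_shift (monomial n a • f)] with x h1 h2
      rw [h2, h1, eval_mul, eval_X, mul_assoc]

lemma coeFn_poly_smul_one (q : ℂ[X]) :
    ∀ᵐ x ∂arc, (q • oneLp : LpT p) x = q.eval (zc x) := by
  filter_upwards [coeFn_poly_smul q (oneLp : LpT p), coeFn_oneLp (p := p)] with x h1 h2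
  rw [h1, h2, mul_one]

lemma poly_smul_eq_zero {q : ℂ[X]} (hq : q ≠ 0) {f : LpT p} (h : q • f = 0) : f = 0 := by
  rw [Lp.eq_zero_iff_ae_eq_zero] at h ⊢
  filter_upwards [h, coeFn_poly_smul q f, ae_eval_ne_zero hq] with x h1 h2 h3
  rw [h1, Pi.zero_apply] at h2
  exact (mul_eq_zero.1 h2.symm).resolve_left h3

lemma poly_smul_left_cancel {q : ℂ[X]} (hq : q ≠ 0) {f g : LpT p} (h : q • f = q • g) : f = g :=
  sub_eq_zero.1 (poly_smul_eq_zero hq (by rw [smul_sub, h, sub_self]))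

lemma poly_smul_one_eq_zero {q : ℂ[X]} (h : q • (oneLp : LpT p) = 0) : q = 0 := by
  by_contra hq
  have h0 := poly_smul_eq_zero hq h
  rw [Lp.eq_zero_iff_ae_eq_zero] at h0
  have : ∀ᵐ _ : UnitAddCircle ∂arc, False := by
    filter_upwards [h0, coeFn_oneLp (p := p)] with x h1 h2
    rw [h2] at h1
    exact one_ne_zero h1
  exact (NeZero.ne arc) (by simpa using this)

/-- On the compact circle `1 / q` is continuous, hence bounded. -/
lemma exists_poly_smul_eq {q : ℂ[X]} (hq : ∀ z ∈ circ, ¬ q.IsRoot z) (f : LpT p) :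
    ∃ g : LpT p, q • g = f := by
  have hne : ∀ x, q.eval (zc x) ≠ 0 := fun x => hq _ (zc_mem_circ x)
  have hcont : Continuous fun x => (q.eval (zc x))⁻¹ := (continuous_eval_zc q).inv₀ hne
  obtain ⟨M, hM⟩ := isCompact_univ.exists_bound_of_continuousOn hcont.continuousOn
  have hmem := memLp_mul_of_bound hcont.aestronglyMeasurable (fun x => hM x (Set.mem_univ x)) f
  refine ⟨hmem.toLp, Lp.ext ?_⟩
  filter_upwards [coeFn_poly_smul q hmem.toLp, hmem.coeFn_toLp] with x h1 h2
  rw [h1, h2, mul_inv_cancel_left₀ (hne x)]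

/-! ### Fourier coefficients -/

lemma fourierCoeff_sub' (f g : LpT p) (n : ℤ) :
    fourierCoeff (f - g : LpT p) n = fourierCoeff f n - fourierCoeff g n := by
  have := fourierCoeff_add' (f - g) g n
  rw [sub_add_cancel] at this
  rw [this, add_sub_cancel_right]

lemma fourierCoeff_shift (f : LpT p) (n : ℤ) :
    fourierCoeff (shift f : LpT p) n = fourierCoeff f (n - 1) := by
  rw [fourierCoeff_congr_ae (coeFn_shift f), fourierCoeff, fourierCoeff]
  congr 1
  ext x
  rw [neg_sub, sub_eq_add_neg, add_comm, fourier_add, smul_eq_mul, smul_eq_mul, zc, mul_assoc]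

lemma fourierCoeff_X_sub_C_smul (α : ℂ) (f : LpT p) (n : ℤ) :
    fourierCoeff ((X - C α : ℂ[X]) • f : LpT p) n =
      fourierCoeff f (n - 1) - α * fourierCoeff f n := by
  rw [sub_smul, fourierCoeff_sub', X_smul, C_smul, fourierCoeff_shift, fourierCoeff_smul']

lemma fourierCoeff_X_pow_smul (k : ℕ) (f : LpT p) (n : ℤ) :
    fourierCoeff ((X ^ k : ℂ[X]) • f : LpT p) n = fourierCoeff f (n - k) := by
  induction k generalizing n with
  | zero => simp
  | succ k ih =>
    rw [pow_succ', mul_smul, X_smul, fourierCoeff_shift, ih]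
    congr 1
    push_cast
    ring

lemma Lp_eq_of_fourierCoeff {f g : LpT p} (h : ∀ n, fourierCoeff f n = fourierCoeff g n) :
    f = g := by
  rw [← sub_eq_zero, Lp.eq_zero_iff_ae_eq_zero]
  refine ae_eq_zero_of_fourierCoeff (integrable_LpT _) fun n => ?_
  rw [fourierCoeff_sub', h, sub_self]

lemma norm_fourierCoeff_le (f : LpT p) (n : ℤ) : ‖fourierCoeff f n‖ ≤ ‖f‖ := by
  have h1 : ‖fourierCoeff f n‖ ≤ ∫ x, ‖f x‖ ∂arc := by
    refine (norm_integral_le_integral_norm _).trans (le_of_eq ?_)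
    congr 1
    ext x
    rw [norm_smul, fourier_apply, Circle.norm_coe, one_mul]
  refine h1.trans ?_
  have h2 := eLpNorm_le_eLpNorm_of_exponent_le (μ := arc) (Fact.out : 1 ≤ p)
    (Lp.aestronglyMeasurable f)
  rw [integral_norm_eq_lintegral_enorm (Lp.aestronglyMeasurable f), ← eLpNorm_one_eq_lintegral_enorm,
    Lp.norm_def]
  exact ENNReal.toReal_mono (Lp.eLpNorm_ne_top f) h2

/-- The Fourier coefficient as a continuous functional. -/
def coeffL (n : ℤ) : LpT p →L[ℂ] ℂ :=
  LinearMap.mkContinuous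
    { toFun := fun f => fourierCoeff f n
      map_add' := fun f g => fourierCoeff_add' f g n
      map_smul' := fun c f => fourierCoeff_smul' c f n } 1
    fun f => by simpa using norm_fourierCoeff_le f n

lemma coeffL_apply (n : ℤ) (f : LpT p) : coeffL n f = fourierCoeff f n := rfl

/-- The Riemann-Lebesgue lemma. -/
lemma tendsto_fourierCoeff_cofinite (hp : p ≠ ⊤) (f : LpT p) :
    Tendsto (fun n => fourierCoeff f n) cofinite (𝓝 0) := by
  have hspan : ∀ g ∈ Submodule.span ℂ (Set.range (@fourierLp (1 : ℝ) _ p _)),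
      ∀ᶠ n in cofinite, fourierCoeff g n = 0 := by
    intro g hg
    induction hg using Submodule.span_induction with
    | mem g hg =>
      obtain ⟨m, rfl⟩ := hg
      filter_upwards [(Set.finite_singleton m).compl_mem_cofinite] with n hn
      rw [fourierCoeff_congr_ae (coeFn_fourierLp p m)]
      have := congrFun (fourierCoeff_fourier (T := 1) m) n
      rw [this, Pi.single_apply, if_neg (by simpa using hn)]
    | zero => exact Eventually.of_forall fun n => fourierCoeff_zero' n
    | add g g' _ _ h1 h2 =>
      filter_upwards [h1, h2] with n a b
      rw [fourierCoeff_add', a, b, add_zero]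
    | smul c g _ h1 =>
      filter_upwards [h1] with n a
      rw [fourierCoeff_smul', a, mul_zero]
  rw [Metric.tendsto_nhds]
  intro ε hε
  -- Trigonometric polynomials are dense because `p` is finite, and each coefficient is a functional
  -- of norm at most `1`.
  have hf : f ∈ closure (Submodule.span ℂ (Set.range (@fourierLp (1 : ℝ) _ p _)) :
      Set (LpT p)) := by
    rw [← Submodule.topologicalClosure_coe, span_fourierLp_closure_eq_top hp]
    trivial
  obtain ⟨g, hg, hfg⟩ := Metric.mem_closure_iff.1 hf ε hε
  filter_upwards [hspan g hg] with n hn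
  rw [dist_zero_right]
  have h := norm_fourierCoeff_le (f - g) n
  rw [fourierCoeff_sub', hn, sub_zero] at h
  exact h.trans_lt (by rwa [← dist_eq_norm])

lemma tendsto_fourierCoeff_add (hp : p ≠ ⊤) (f : LpT p) (n : ℤ) :
    Tendsto (fun k : ℕ => fourierCoeff f (n + k)) atTop (𝓝 0) := by
  refine (tendsto_fourierCoeff_cofinite hp f).comp ?_
  rw [← Nat.cofinite_eq_atTop]
  exact Function.Injective.tendsto_cofinite fun a b h => by simpa using h

lemma tendsto_fourierCoeff_sub (hp : p ≠ ⊤) (f : LpT p) (n : ℤ) :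
    Tendsto (fun k : ℕ => fourierCoeff f (n - k)) atTop (𝓝 0) := by
  refine (tendsto_fourierCoeff_cofinite hp f).comp ?_
  rw [← Nat.cofinite_eq_atTop]
  exact Function.Injective.tendsto_cofinite fun a b h => by simpa using h

/-! ### Division in the Hardy space -/

/-- Induction over the roots of a polynomial with all its roots in `S`. -/
lemma induction_on_roots {S : Set ℂ} {M : ℂ[X] → Prop} (hC : ∀ c : ℂ, c ≠ 0 → M (C c))
    (hmul : ∀ a ∈ S, ∀ q : ℂ[X], q ≠ 0 → (∀ z, q.IsRoot z → z ∈ S) → M q → M ((X - C a) * q))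
    {q : ℂ[X]} (hq : q ≠ 0) (hS : ∀ z, q.IsRoot z → z ∈ S) : M q := by
  induction hn : q.natDegree generalizing q with
  | zero =>
    rw [natDegree_eq_zero] at hn
    obtain ⟨c, rfl⟩ := hn
    exact hC c (by simpa using hq)
  | succ n ih =>
    obtain ⟨a, ha⟩ := Complex.exists_root (f := q)
      (natDegree_pos_iff_degree_pos.1 (by omega))
    obtain ⟨r, rfl⟩ := dvd_iff_isRoot.2 ha
    have hr : r ≠ 0 := right_ne_zero_of_mul hq
    have hrS : ∀ z, r.IsRoot z → z ∈ S := fun z hz => hS z (root_mul.2 (Or.inr hz))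
    refine hmul a (hS a ha) r hr hrS (ih hr hrS ?_)
    rw [natDegree_mul (X_sub_C_ne_zero a) hr, natDegree_X_sub_C] at hn
    omega

lemma mem_hardy {f : LpT p} : f ∈ Hardy p ↔ ∀ n : ℤ, n < 0 → fourierCoeff f n = 0 := Iff.rfl

/-- The functions in `L^p` whose Fourier coefficients of index at least `N` vanish. -/
def coHardyBelow (p : ℝ≥0∞) [Fact (1 ≤ p)] (N : ℤ) : Submodule ℂ (LpT p) where
  carrier := {f | ∀ n : ℤ, N ≤ n → fourierCoeff f n = 0}
  zero_mem' := fun n _ => fourierCoeff_zero' n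
  add_mem' := fun {f g} hf hg n hn => by rw [fourierCoeff_add', hf n hn, hg n hn, add_zero]
  smul_mem' := fun c f hf n hn => by rw [fourierCoeff_smul', hf n hn, mul_zero]

lemma coHardyBelow_mono {M N : ℤ} (h : M ≤ N) : coHardyBelow p M ≤ coHardyBelow p N :=
  fun _ hf n hn => hf n (h.trans hn)

lemma isClosed_hardy : IsClosed (Hardy p : Set (LpT p)) := by
  have : (Hardy p : Set (LpT p)) = ⋂ n : ℤ, ⋂ _ : n < 0, {f | coeffL n f = 0} := by
    ext f
    simp [mem_hardy, coeffL_apply]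
  rw [this]
  exact isClosed_iInter fun n => isClosed_iInter fun _ =>
    isClosed_eq (coeffL n).continuous continuous_const

instance : CompleteSpace (Hardy p) := isClosed_hardy.completeSpace_coe

lemma poly_smul_mem_hardy (q : ℂ[X]) {f : LpT p} (hf : f ∈ Hardy p) : q • f ∈ Hardy p := by
  rw [q.as_sum_range_C_mul_X_pow, Finset.sum_smul]
  refine Submodule.sum_mem _ fun i _ => ?_
  rw [mul_smul, C_smul]
  refine Submodule.smul_mem _ _ fun n hn => ?_
  rw [fourierCoeff_X_pow_smul]
  exact hf _ (by omega)

lemma oneLp_mem_hardy : (oneLp : LpT p) ∈ Hardy p := fun n hn => by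
  rw [fourierCoeff_oneLp, if_neg hn.ne]

lemma poly_smul_one_mem_hardy (q : ℂ[X]) : q • (oneLp : LpT p) ∈ Hardy p :=
  poly_smul_mem_hardy q oneLp_mem_hardy

lemma poly_smul_mem_coHardyBelow {q : ℂ[X]} {m : ℕ} (hq : q.natDegree ≤ m) {N : ℤ} {f : LpT p}
    (hf : f ∈ coHardyBelow p N) : q • f ∈ coHardyBelow p (N + m) := by
  rw [q.as_sum_range_C_mul_X_pow' (Nat.lt_succ_of_le hq), Finset.sum_smul]
  refine Submodule.sum_mem _ fun i hi => ?_
  rw [mul_smul, C_smul]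
  refine Submodule.smul_mem _ _ fun n hn => ?_
  rw [fourierCoeff_X_pow_smul]
  rw [Finset.mem_range] at hi
  exact hf _ (by omega)

lemma poly_smul_one_mem_coHardyBelow {q : ℂ[X]} {m : ℕ} (hq : q.degree < m) :
    q • (oneLp : LpT p) ∈ coHardyBelow p m := by
  rcases eq_or_ne q 0 with rfl | h0
  · simp
  have h1 : (oneLp : LpT p) ∈ coHardyBelow p 1 := fun n hn => by
    rw [fourierCoeff_oneLp, if_neg (by omega)]
  have h2 := (natDegree_lt_iff_degree_lt h0).2 hq
  exact coHardyBelow_mono (by omega) (poly_smul_mem_coHardyBelow le_rfl h1)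

/-- From index `N` on the coefficients satisfy `f̂(m) = α f̂(m + 1)`, so their moduli do not
decrease as `m → ∞`. By Riemann–Lebesgue they vanish. The case `|α| = 1` is included. -/
lemma mem_coHardyBelow_of_X_sub_C_smul (hp : p ≠ ⊤) {α : ℂ} (hα : ‖α‖ ≤ 1) {N : ℤ} {f : LpT p}
    (h : (X - C α : ℂ[X]) • f ∈ coHardyBelow p (N + 1)) : f ∈ coHardyBelow p N := by
  intro n hn
  have hstep : ∀ m : ℤ, N ≤ m → fourierCoeff f m = α * fourierCoeff f (m + 1) := fun m hm => by
    have := h (m + 1) (by omega)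
    rwa [fourierCoeff_X_sub_C_smul, add_sub_cancel_right, sub_eq_zero] at this
  have hle : ∀ k : ℕ, ‖fourierCoeff f n‖ ≤ ‖fourierCoeff f (n + k)‖ := by
    intro k
    induction k with
    | zero => simp
    | succ k ih =>
      refine ih.trans ?_
      rw [hstep (n + k) (by omega), norm_mul, Nat.cast_succ, ← add_assoc]
      exact mul_le_of_le_one_left (norm_nonneg _) hα
  have hlim := (tendsto_fourierCoeff_add hp f n).norm
  rw [norm_zero] at hlim
  exact norm_le_zero_iff.1 (ge_of_tendsto' hlim hle)

lemma mem_coHardyBelow_of_poly_smul (hp : p ≠ ⊤) {d : ℂ[X]} (hd : d ≠ 0)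
    (hroots : ∀ z, d.IsRoot z → ‖z‖ ≤ 1) {N : ℤ} {f : LpT p}
    (h : d • f ∈ coHardyBelow p (N + d.natDegree)) : f ∈ coHardyBelow p N := by
  revert f N
  refine induction_on_roots (S := {z | ‖z‖ ≤ 1}) (M := fun d => ∀ {N : ℤ} {f : LpT p},
    d • f ∈ coHardyBelow p (N + d.natDegree) → f ∈ coHardyBelow p N) ?_ ?_ hd hroots
  · intro c hc N f h
    rw [C_smul, natDegree_C] at h
    simpa using (Submodule.smul_mem_iff _ hc).1 h
  · intro a ha q hq _ ih N f h
    rw [natDegree_mul (X_sub_C_ne_zero a) hq, natDegree_X_sub_C, mul_comm, mul_smul] at h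
    refine mem_coHardyBelow_of_X_sub_C_smul hp ha (ih ?_)
    convert h using 2
    push_cast
    ring

/-- The mirror argument: `f̂(m - 1) = β f̂(m)` for `m < 0`, so the moduli do not decrease as `m →
-∞`. -/
lemma mem_hardy_of_X_sub_C_smul (hp : p ≠ ⊤) {β : ℂ} (hβ : 1 ≤ ‖β‖) {f : LpT p}
    (h : (X - C β : ℂ[X]) • f ∈ Hardy p) : f ∈ Hardy p := by
  intro n hn
  have hstep : ∀ m : ℤ, m < 0 → fourierCoeff f (m - 1) = β * fourierCoeff f m := fun m hm => by
    have := h m hm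
    rwa [fourierCoeff_X_sub_C_smul, sub_eq_zero] at this
  have hle : ∀ k : ℕ, ‖fourierCoeff f n‖ ≤ ‖fourierCoeff f (n - k)‖ := by
    intro k
    induction k with
    | zero => simp
    | succ k ih =>
      refine ih.trans ?_
      rw [Nat.cast_succ, ← sub_sub, hstep (n - k) (by omega), norm_mul]
      exact le_mul_of_one_le_left (norm_nonneg _) hβ
  have hlim := (tendsto_fourierCoeff_sub hp f n).norm
  rw [norm_zero] at hlim
  exact norm_le_zero_iff.1 (ge_of_tendsto' hlim hle)

lemma mem_hardy_of_poly_smul (hp : p ≠ ⊤) {e : ℂ[X]} (he : e ≠ 0)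
    (hroots : ∀ z, e.IsRoot z → 1 ≤ ‖z‖) {f : LpT p} (h : e • f ∈ Hardy p) : f ∈ Hardy p := by
  revert f
  refine induction_on_roots (S := {z | 1 ≤ ‖z‖}) (M := fun e => ∀ {f : LpT p},
    e • f ∈ Hardy p → f ∈ Hardy p) ?_ ?_ he hroots
  · intro c hc f h
    rw [C_smul] at h
    exact (Submodule.smul_mem_iff _ hc).1 h
  · intro a ha q hq _ ih f h
    rw [mul_comm, mul_smul] at h
    exact mem_hardy_of_X_sub_C_smul hp ha (ih h)

lemma fourierCoeff_poly_smul_one (q : ℂ[X]) (n : ℕ) :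
    fourierCoeff (q • oneLp : LpT p) n = q.coeff n := by
  have hsum : ∀ q : ℂ[X], coeffL (p := p) n (q • oneLp) = q.coeff n := by
    intro q
    induction q using Polynomial.induction_on' with
    | add q r hq hr => rw [add_smul, map_add, hq, hr, coeff_add]
    | monomial k a =>
      rw [← C_mul_X_pow_eq_monomial, mul_smul, C_smul, map_smul, coeffL_apply,
        fourierCoeff_X_pow_smul, fourierCoeff_oneLp, coeff_C_mul, coeff_X_pow, smul_eq_mul]
      simp [sub_eq_zero]
  exact hsum q

lemma exists_poly_of_mem {f : LpT p} (h1 : f ∈ Hardy p) {m : ℕ} (h2 : f ∈ coHardyBelow p m) :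
    ∃ r : ℂ[X], r.degree < m ∧ f = r • oneLp := by
  refine ⟨∑ i ∈ Finset.range m, C (fourierCoeff f i) * X ^ i, ?_, ?_⟩
  · rw [← mem_degreeLT]
    refine Submodule.sum_mem _ fun i hi => mem_degreeLT.2 ?_
    exact (degree_C_mul_X_pow_le _ _).trans_lt (by exact_mod_cast Finset.mem_range.1 hi)
  · refine Lp_eq_of_fourierCoeff fun n => ?_
    rcases lt_or_ge n 0 with hn | hn
    · rw [h1 n hn, poly_smul_one_mem_hardy _ n hn]
    · lift n to ℕ using hn
      rw [fourierCoeff_poly_smul_one]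
      simp only [finsetSum_coeff, coeff_C_mul_X_pow]
      rw [Finset.sum_ite_eq (Finset.range m) n]
      split_ifs with h
      · rfl
      · rw [Finset.mem_range, not_lt] at h
        exact h2 n (by omega)

lemma eq_zero_of_mem {f : LpT p} (h1 : f ∈ Hardy p) (h2 : f ∈ coHardyBelow p 0) : f = 0 :=
  (Submodule.disjoint_def.1 (disjoint_hardy p)) f h1 h2

/-- The recursion `f̂(m - 1) = α f̂(m)` for `m < 0` makes the negative part of `f` the multiple
`f̂(-1) / (z - α)`, which lies in `K^p`. -/
lemma exists_hardy_add_coHardy_of_X_sub_C_smul (hp : p ≠ ⊤) {α : ℂ} (hα : ‖α‖ < 1) {f : LpT p}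
    (h : (X - C α : ℂ[X]) • f ∈ Hardy p) : ∃ u ∈ Hardy p, f - u ∈ coHardyBelow p 0 := by
  -- `e` is `1 / (z - α)`, with leading coefficient `1` at index `-1`.
  obtain ⟨e, he⟩ := exists_poly_smul_eq (q := X - C α) (fun z hz h0 => by
    rw [root_X_sub_C] at h0
    have : ‖z‖ = 1 := hz
    rw [← h0] at this
    linarith) (oneLp : LpT p)
  have heK : e ∈ coHardyBelow p 0 := by
    refine mem_coHardyBelow_of_X_sub_C_smul hp hα.le fun n hn => ?_
    rw [he, fourierCoeff_oneLp, if_neg (by omega)]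
  have he1 : fourierCoeff e (-1) = 1 := by
    have h1 := fourierCoeff_X_sub_C_smul α e 0
    rw [he, fourierCoeff_oneLp, if_pos rfl, heK 0 le_rfl] at h1
    simpa using h1.symm
  refine ⟨f - fourierCoeff f (-1) • e, ?_, by simpa using Submodule.smul_mem _ _ heK⟩
  set u := f - fourierCoeff f (-1) • e with hu
  have hu1 : fourierCoeff u (-1) = 0 := by
    rw [hu, fourierCoeff_sub', fourierCoeff_smul', he1, mul_one, sub_self]
  have hXu : (X - C α : ℂ[X]) • u ∈ Hardy p := by
    rw [hu, smul_sub, smul_comm, he]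
    exact Submodule.sub_mem _ h (Submodule.smul_mem _ _ oneLp_mem_hardy)
  have hk : ∀ k : ℕ, fourierCoeff u (-1 - k) = 0 := by
    intro k
    induction k with
    | zero => simpa using hu1
    | succ k ih =>
      have := hXu (-1 - k) (by omega)
      rw [fourierCoeff_X_sub_C_smul, ih, mul_zero, sub_zero] at this
      rw [Nat.cast_succ, ← sub_sub, this]
  intro n hn
  obtain ⟨k, rfl⟩ : ∃ k : ℕ, n = -1 - k := ⟨(-1 - n).toNat, by omega⟩
  exact hk k

/-- This provides the splitting `H^p ⊕ K^p` for the functions that occur, by elementary division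
instead of the theorem of M. Riesz. -/
lemma exists_hardy_add_coHardy (hp : p ≠ ⊤) {q : ℂ[X]} (hq : q ≠ 0)
    (hroots : ∀ z, q.IsRoot z → z ∈ disc) {f : LpT p} (h : q • f ∈ Hardy p) :
    ∃ u ∈ Hardy p, f - u ∈ coHardyBelow p 0 := by
  -- The hypothesis is weakened to `q f ∈ H^p + K^p`, which is stable under induction over the
  -- roots.
  suffices H : ∀ {f : LpT p}, (∃ u ∈ Hardy p, q • f - u ∈ coHardyBelow p 0) →
      ∃ u ∈ Hardy p, f - u ∈ coHardyBelow p 0 from H ⟨_, h, by simp⟩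
  refine induction_on_roots (S := disc) (M := fun q => ∀ {f : LpT p},
    (∃ u ∈ Hardy p, q • f - u ∈ coHardyBelow p 0) →
      ∃ u ∈ Hardy p, f - u ∈ coHardyBelow p 0) ?_ ?_ hq hroots
  · rintro c hc f ⟨u, hu, hfu⟩
    refine ⟨c⁻¹ • u, Submodule.smul_mem _ _ hu, ?_⟩
    rw [C_smul] at hfu
    have := Submodule.smul_mem _ c⁻¹ hfu
    rwa [smul_sub, inv_smul_smul₀ hc] at this
  · rintro a ha q - - ih f ⟨u, hu, hfu⟩
    rw [mul_comm, mul_smul] at hfu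
    obtain ⟨v, hv, hfv⟩ := ih ⟨u, hu, hfu⟩
    have ha' : ‖a‖ < 1 := ha
    obtain ⟨k, hk⟩ := exists_poly_smul_eq (q := X - C a) (fun z hz h0 => by
      rw [root_X_sub_C] at h0
      have : ‖z‖ = 1 := hz
      rw [← h0] at this
      linarith) ((X - C a : ℂ[X]) • f - v)
    have hkK : k ∈ coHardyBelow p 0 := by
      refine mem_coHardyBelow_of_X_sub_C_smul hp ha'.le ?_
      rw [hk]
      exact coHardyBelow_mono (by omega) hfv
    obtain ⟨w, hw, hfw⟩ := exists_hardy_add_coHardy_of_X_sub_C_smul hp ha' (f := f - k) (by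
      rw [smul_sub, hk, sub_sub_cancel]
      exact hv)
    refine ⟨w, hw, ?_⟩
    have := Submodule.add_mem _ hfw hkK
    rwa [show f - k - w + k = f - w by abel] at this

lemma not_isRoot_of_mem_circ {q : ℂ[X]} (hroots : ∀ z, q.IsRoot z → z ∈ disc) :
    ∀ z ∈ circ, ¬ q.IsRoot z := fun z hz h => by
  have h1 : ‖z‖ < 1 := hroots z h
  have h2 : ‖z‖ = 1 := hz
  linarith

/-- Division with remainder in `H^p` by a polynomial with all its roots in the disc. -/
lemma exists_hardy_div (hp : p ≠ ⊤) {q : ℂ[X]} (hq : q ≠ 0)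
    (hroots : ∀ z, q.IsRoot z → z ∈ disc) {h : LpT p} (hh : h ∈ Hardy p) :
    ∃ g ∈ Hardy p, ∃ r : ℂ[X], r.degree < q.degree ∧ h = q • g + r • oneLp := by
  obtain ⟨f, hf⟩ := exists_poly_smul_eq (not_isRoot_of_mem_circ hroots) h
  obtain ⟨g, hg, hk⟩ := exists_hardy_add_coHardy hp hq hroots (f := f) (by rwa [hf])
  -- With `f = h / q`, the remainder `h - q g = q (f - g)` is in `H^p` and has no coefficients from
  -- index `deg q` on, so it is a polynomial.
  have h1 : q • (f - g) ∈ Hardy p := by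
    rw [smul_sub, hf]
    exact Submodule.sub_mem _ hh (poly_smul_mem_hardy q hg)
  have h2 := poly_smul_mem_coHardyBelow (q := q) le_rfl hk
  rw [zero_add] at h2
  obtain ⟨r, hr, hr'⟩ := exists_poly_of_mem h1 h2
  refine ⟨g, hg, r, by rwa [degree_eq_natDegree hq], ?_⟩
  rw [← hr', smul_sub, hf]
  abel

/-- Division in `H^p` by a polynomial without roots in the closed disc. -/
lemma exists_hardy_div_outer (hp : p ≠ ⊤) {e : ℂ[X]} (he : e ≠ 0)
    (hroots : ∀ z, e.IsRoot z → 1 < ‖z‖) {h : LpT p} (hh : h ∈ Hardy p) :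
    ∃ g ∈ Hardy p, e • g = h := by
  obtain ⟨g, hg⟩ := exists_poly_smul_eq (q := e) (fun z hz h0 => (hroots z h0).ne' hz) h
  exact ⟨g, mem_hardy_of_poly_smul hp he (fun z hz => (hroots z hz).le) (by rwa [hg]), hg⟩

/-- A multiple in `H^p` of a polynomial with all its roots in the closed disc is not a nonzero
polynomial of smaller degree. -/
lemma eq_zero_of_poly_smul_eq_poly (hp : p ≠ ⊤) {d : ℂ[X]} (hd : d ≠ 0)
    (hroots : ∀ z, d.IsRoot z → ‖z‖ ≤ 1) {r : ℂ[X]} (hr : r.degree < d.degree) {g : LpT p}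
    (hg : g ∈ Hardy p) (h : d • g = r • oneLp) : g = 0 := by
  refine eq_zero_of_mem hg (mem_coHardyBelow_of_poly_smul hp hd hroots ?_)
  rw [h, zero_add]
  exact poly_smul_one_mem_coHardyBelow (by rwa [← degree_eq_natDegree hd])

/-! ### The graph of the Toeplitz-like operator -/

lemma exists_eq_mul_of_roots (S : Set ℂ) {q : ℂ[X]} (hq : q ≠ 0) :
    ∃ a b : ℂ[X], q = a * b ∧ (∀ z, a.IsRoot z → z ∈ S) ∧ ∀ z, b.IsRoot z → z ∉ S := by
  refine induction_on_roots (S := Set.univ) (M := fun q => ∃ a b : ℂ[X], q = a * b ∧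
    (∀ z, a.IsRoot z → z ∈ S) ∧ ∀ z, b.IsRoot z → z ∉ S) ?_ ?_ hq (fun _ _ => trivial)
  · intro c hc
    exact ⟨1, C c, by simp, by simp, by simp [hc]⟩
  · rintro z - q - - ⟨a, b, rfl, ha, hb⟩
    by_cases hz : z ∈ S
    · refine ⟨(X - C z) * a, b, by ring, fun y hy => ?_, hb⟩
      rcases root_mul.1 hy with h | h
      exacts [root_X_sub_C.1 h ▸ hz, ha y h]
    · refine ⟨a, (X - C z) * b, by ring, ha, fun y hy => ?_⟩
      rcases root_mul.1 hy with h | h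
      exacts [root_X_sub_C.1 h ▸ hz, hb y h]

lemma onCircle_eq_of_eq_div {ω : RatFunc ℂ} {N D : ℂ[X]} (hD : D ≠ 0)
    (hω : ω = algebraMap ℂ[X] (RatFunc ℂ) N / algebraMap ℂ[X] (RatFunc ℂ) D) :
    ∀ᵐ x ∂arc, D.eval (zc x) ≠ 0 ∧ onCircle ω x = N.eval (zc x) / D.eval (zc x) := by
  have h := (RatFunc.num_mul_eq_mul_denom_iff hD).2 hω
  filter_upwards [ae_eval_ne_zero hD, ae_eval_ne_zero ω.denom_ne_zero] with x h1 h2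
  have h3 := congrArg (eval (zc x)) h
  rw [eval_mul, eval_mul] at h3
  exact ⟨h1, by rw [onCircle_eq, div_eq_div_iff h2 h1, h3]⟩

lemma isCoprime_of_roots {a b : ℂ[X]} (h : ∀ z, a.IsRoot z → ¬ b.IsRoot z) : IsCoprime a b := by
  rw [← EuclideanDomain.gcd_isUnit_iff, isUnit_iff_degree_eq_zero]
  by_contra hd
  obtain ⟨z, hz⟩ := IsAlgClosed.exists_root _ hd
  exact h z (hz.dvd (EuclideanDomain.gcd_dvd_left a b)) (hz.dvd (EuclideanDomain.gcd_dvd_right a b))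

lemma exists_partial_fractions {a b r : ℂ[X]} (hab : IsCoprime a b) (ha : a ≠ 0) (hb : b ≠ 0)
    (hr : r.degree < (a * b).degree) :
    ∃ s t : ℂ[X], s.degree < a.degree ∧ t.degree < b.degree ∧ r = s * b + t * a := by
  obtain ⟨u, v, huv⟩ := hab
  have hs := EuclideanDomain.mod_lt (r * v) ha
  have e : r = (r * v % a) * b + (r * u + r * v / a * b) * a := by
    have := EuclideanDomain.div_add_mod (r * v) a
    linear_combination (-r) * huv - b * this
  refine ⟨r * v % a, _, hs, ?_, e⟩
  -- The bound on the second numerator `t` comes from `t a = r - s b`, after cancelling `deg a`.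
  have hdeg : ((r * u + r * v / a * b) * a).degree < (a * b).degree := by
    rw [show (r * u + r * v / a * b) * a = r - r * v % a * b by
      rw [eq_sub_iff_add_eq']
      exact e.symm]
    refine (degree_sub_le _ _).trans_lt (max_lt hr ?_)
    rw [degree_mul, degree_mul]
    exact WithBot.add_lt_add_right (degree_ne_bot.2 hb) hs
  rw [mul_comm a b, degree_mul, degree_mul] at hdeg
  exact lt_of_add_lt_add_right hdeg

/-- Put `f' = N g / e`, which is in `H^p`. Then `f' - d h = d (f - h) + d ρ`, where `f - h ∈ K^p`
and `ρ` is strictly proper, so all coefficients of index at least `deg d` vanish. A function in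
`H^p` with this property is a polynomial, the desired `r`. -/
lemma exists_of_mem_toeplitzGraph (hp : p ≠ ⊤) {ω : RatFunc ℂ} {N d e : ℂ[X]} (hd : d ≠ 0)
    (he : e ≠ 0) (hdr : ∀ z, d.IsRoot z → ‖z‖ ≤ 1) (her : ∀ z, e.IsRoot z → 1 < ‖z‖)
    (hω : ω = algebraMap ℂ[X] (RatFunc ℂ) N / algebraMap ℂ[X] (RatFunc ℂ) (d * e))
    {g h : Hardy p} (hgh : (g, h) ∈ toeplitzGraph p ω) :
    ∃ r : ℂ[X], r.degree < d.degree ∧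
      N • (g : LpT p) = (d * e) • (h : LpT p) + (e * r) • oneLp := by
  obtain ⟨f, ρ, hρ, h1, h2⟩ := hgh
  dsimp only at h1 h2
  have key : (N * ρ.denom) • (g : LpT p) =
      (d * e * ρ.denom) • f + (d * e * ρ.num) • oneLp := by
    refine Lp.ext ?_
    filter_upwards [h1, onCircle_eq_of_eq_div (mul_ne_zero hd he) hω,
      ae_eval_ne_zero ρ.denom_ne_zero, coeFn_poly_smul (N * ρ.denom) (g : LpT p),
      coeFn_poly_smul (d * e * ρ.denom) f, coeFn_poly_smul_one (p := p) (d * e * ρ.num),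
      Lp.coeFn_add ((d * e * ρ.denom) • f) ((d * e * ρ.num) • oneLp)] with x a1 a2 a3 a4 a5 a6 a7
    rw [a7, Pi.add_apply, a4, a5, a6]
    obtain ⟨b1, b2⟩ := a2
    rw [b2, onCircle_eq] at a1
    simp only [eval_mul] at a1 b1 ⊢
    have b3 := left_ne_zero_of_mul b1
    have b4 := right_ne_zero_of_mul b1
    field_simp at a1
    linear_combination a1
  obtain ⟨a, b, rfl, ha, hb⟩ := exists_eq_mul_of_roots disc hd
  have ha0 := left_ne_zero_of_mul hd
  have hb0 := right_ne_zero_of_mul hd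
  -- The remaining factors `b`, `e` and `ρ.denom` have no roots in the open disc and can be divided
  -- out within `H^p`.
  have haf : a • f ∈ Hardy p := by
    refine mem_hardy_of_poly_smul hp (mul_ne_zero (mul_ne_zero hb0 he) ρ.denom_ne_zero)
      (fun z hz => ?_) ?_
    · rcases root_mul.1 hz with hz | hz
      · rcases root_mul.1 hz with hz | hz
        exacts [not_lt.1 (hb z hz), (her z hz).le]
      · exact (hρ.2 z hz).ge
    · have : (b * e * ρ.denom) • a • f =
          (N * ρ.denom) • (g : LpT p) - (a * b * e * ρ.num) • oneLp := by
        rw [key]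
        module
      rw [this]
      exact Submodule.sub_mem _ (poly_smul_mem_hardy _ g.2) (poly_smul_one_mem_hardy _)
  obtain ⟨u, hu, hk⟩ := exists_hardy_add_coHardy hp ha0 ha haf
  have hhu : (h : LpT p) = u := by
    have e1 : rieszProj p f = rieszProj p ((⟨u, hu⟩ : Hardy p) : LpT p) + rieszProj p (f - u) := by
      rw [← map_add]
      simp
    rw [rieszProj_hardy, rieszProj_coHardy hk, add_zero] at e1
    rw [h2, e1]
  obtain ⟨f', hf', hef⟩ := exists_hardy_div_outer hp he her (poly_smul_mem_hardy N g.2)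
  -- This difference is `d ρ`, possibly not a polynomial a priori; multiplied by `ρ.denom` it
  -- becomes the polynomial `d ρ.num`.
  have hv : f' - (a * b) • f ∈ coHardyBelow p (a * b).natDegree := by
    refine mem_coHardyBelow_of_poly_smul hp ρ.denom_ne_zero (fun z hz => (hρ.2 z hz).le) ?_
    have : ρ.denom • (f' - (a * b) • f) = (a * b * ρ.num) • (oneLp : LpT p) := by
      refine poly_smul_left_cancel he ?_
      have e1 : e • ρ.denom • (f' - (a * b) • f) =
          ρ.denom • (e • f') - (a * b * e * ρ.denom) • f := by module
      have e2 : ρ.denom • N • (g : LpT p) = (N * ρ.denom) • (g : LpT p) := by module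
      rw [e1, hef, e2, key]
      module
    rw [this, ← Nat.cast_add, ← natDegree_mul hd ρ.denom_ne_zero]
    refine poly_smul_one_mem_coHardyBelow ?_
    rw [← degree_eq_natDegree (mul_ne_zero hd ρ.denom_ne_zero), degree_mul, degree_mul (p := a * b)]
    exact WithBot.add_lt_add_left (degree_ne_bot.2 hd) hρ.1
  have hw : f' - (a * b) • (h : LpT p) ∈ coHardyBelow p (a * b).natDegree := by
    have h3 := poly_smul_mem_coHardyBelow (q := a * b) le_rfl hk
    rw [zero_add] at h3
    have := Submodule.add_mem _ hv h3
    rwa [hhu, show f' - (a * b) • u = f' - (a * b) • f + (a * b) • (f - u) by module]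
  obtain ⟨r, hr, hr'⟩ := exists_poly_of_mem
    (Submodule.sub_mem _ hf' (poly_smul_mem_hardy (a * b) h.2)) hw
  refine ⟨r, by rwa [degree_eq_natDegree hd], ?_⟩
  rw [← hef, mul_smul e r, ← hr']
  module

/-- Here `ω g = h + r / d`. With `d = a b` split into disc and circle roots, `r / d = s / a + t /
b`. The term `k = s / a` lies in `K^p` and is absorbed in `f = h + k`; the term `t / b` is `ρ`. -/
lemma mem_toeplitzGraph_of_eq (hp : p ≠ ⊤) {ω : RatFunc ℂ} {N d e : ℂ[X]} (hd : d ≠ 0)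
    (he : e ≠ 0) (hdr : ∀ z, d.IsRoot z → ‖z‖ ≤ 1)
    (hω : ω = algebraMap ℂ[X] (RatFunc ℂ) N / algebraMap ℂ[X] (RatFunc ℂ) (d * e))
    {g h : Hardy p} {r : ℂ[X]} (hr : r.degree < d.degree)
    (hgh : N • (g : LpT p) = (d * e) • (h : LpT p) + (e * r) • oneLp) :
    (g, h) ∈ toeplitzGraph p ω := by
  obtain ⟨a, b, rfl, ha, hb⟩ := exists_eq_mul_of_roots disc hd
  have ha0 := left_ne_zero_of_mul hd
  have hb0 := right_ne_zero_of_mul hd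
  obtain ⟨s, t, hs, ht, rfl⟩ := exists_partial_fractions
    (isCoprime_of_roots fun z hz hz' => hb z hz' (ha z hz)) ha0 hb0 hr
  obtain ⟨k, hk⟩ := exists_poly_smul_eq (p := p) (not_isRoot_of_mem_circ ha) (s • oneLp)
  have hkK : k ∈ coHardyBelow p 0 := by
    refine mem_coHardyBelow_of_poly_smul hp ha0 (fun z hz => le_of_lt (ha z hz)) ?_
    rw [hk, zero_add]
    exact poly_smul_one_mem_coHardyBelow (by rwa [← degree_eq_natDegree ha0])
  set ρ : RatFunc ℂ := algebraMap ℂ[X] (RatFunc ℂ) t / algebraMap ℂ[X] (RatFunc ℂ) b with hρ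
  refine ⟨h + k, ρ, ?_, ?_, ?_⟩
  · refine ratZero_aux ((RatFunc.num_mul_eq_mul_denom_iff hb0).2 hρ) ht fun z hz => ?_
    exact le_antisymm (hdr z (root_mul.2 (Or.inr hz))) (not_lt.1 (hb z hz))
  · have hk' := congrArg (fun f : LpT p => (f : UnitAddCircle → ℂ)) hk
    have hgh' := congrArg (fun f : LpT p => (f : UnitAddCircle → ℂ)) hgh
    dsimp only at hk' hgh' ⊢
    filter_upwards [onCircle_eq_of_eq_div (mul_ne_zero hd he) hω, onCircle_eq_of_eq_div hb0 hρ,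
      coeFn_poly_smul N (g : LpT p), coeFn_poly_smul (a * b * e) (h : LpT p),
      coeFn_poly_smul_one (p := p) (e * (s * b + t * a)),
      Lp.coeFn_add ((a * b * e) • (h : LpT p)) ((e * (s * b + t * a)) • oneLp),
      coeFn_poly_smul a k, coeFn_poly_smul_one (p := p) s, Lp.coeFn_add (h : LpT p) k]
      with x ⟨b1, b2⟩ ⟨b3, b4⟩ a3 a4 a5 a6 a7 a8 a9
    have c1 := congrFun hk' x
    have c2 := congrFun hgh' x
    rw [a7, a8] at c1
    rw [a3, a6, Pi.add_apply, a4, a5] at c2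
    rw [b2, b4, a9, Pi.add_apply]
    simp only [eval_mul, eval_add] at c2 b1 ⊢
    rw [← c1] at c2
    obtain ⟨⟨d1, d2⟩, d3⟩ : (a.eval (zc x) ≠ 0 ∧ b.eval (zc x) ≠ 0) ∧ e.eval (zc x) ≠ 0 := by
      simpa [not_or] using b1
    field_simp
    linear_combination c2
  · rw [map_add, rieszProj_hardy, rieszProj_coHardy hkK, add_zero]

lemma mem_toeplitzGraph_iff (hp : p ≠ ⊤) {ω : RatFunc ℂ} {N d e : ℂ[X]} (hd : d ≠ 0)
    (he : e ≠ 0) (hdr : ∀ z, d.IsRoot z → ‖z‖ ≤ 1) (her : ∀ z, e.IsRoot z → 1 < ‖z‖)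
    (hω : ω = algebraMap ℂ[X] (RatFunc ℂ) N / algebraMap ℂ[X] (RatFunc ℂ) (d * e))
    {g h : Hardy p} :
    (g, h) ∈ toeplitzGraph p ω ↔ ∃ r : ℂ[X], r.degree < d.degree ∧
      N • (g : LpT p) = (d * e) • (h : LpT p) + (e * r) • oneLp :=
  ⟨exists_of_mem_toeplitzGraph hp hd he hdr her hω,
    fun ⟨_, hr, hgh⟩ => mem_toeplitzGraph_of_eq hp hd he hdr hω hr hgh⟩

lemma toeplitz_graph (ω : RatFunc ℂ) : (toeplitz p ω).graph = toeplitzGraph p ω :=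
  Submodule.toLinearPMap_graph_eq _ (toeplitzGraph_wellDefined p ω)

lemma bijective_toeplitz_iff (ω : RatFunc ℂ) :
    Function.Bijective (toeplitz p ω) ↔
      (∀ h : Hardy p, ∃ g : Hardy p, (g, h) ∈ toeplitzGraph p ω) ∧
        ∀ g : Hardy p, (g, 0) ∈ toeplitzGraph p ω → g = 0 := by
  have hg : ∀ {g h : Hardy p}, (g, h) ∈ toeplitzGraph p ω ↔
      ∃ y : (toeplitz p ω).domain, (y : Hardy p) = g ∧ toeplitz p ω y = h := by
    intro g h
    rw [← toeplitz_graph, LinearPMap.mem_graph_iff]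
  constructor
  · rintro ⟨hi, hs⟩
    refine ⟨fun h => ?_, fun g hg0 => ?_⟩
    · obtain ⟨y, hy⟩ := hs h
      exact ⟨y, hg.2 ⟨y, rfl, hy⟩⟩
    · obtain ⟨y, rfl, hy⟩ := hg.1 hg0
      rw [← LinearPMap.map_zero (toeplitz p ω)] at hy
      rw [hi hy]
      rfl
  · rintro ⟨hs, hi⟩
    refine ⟨fun x y hxy => ?_, fun h => ?_⟩
    · have := hi ((x - y : (toeplitz p ω).domain) : Hardy p)
        (hg.2 ⟨x - y, rfl, by rw [LinearPMap.map_sub, hxy, sub_self]⟩)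
      exact sub_eq_zero.1 (Subtype.ext this)
    · obtain ⟨g, hgh⟩ := hs h
      obtain ⟨y, -, hy⟩ := hg.1 hgh
      exact ⟨y, hy⟩

/-! ### The range of multiplication by `z - α` with `α` on the circle -/

/-- The averages of the powers of `z / α`. -/
def powerMean (α : ℂ) (n : ℕ) : ℂ[X] :=
  C ((n : ℂ) + 1)⁻¹ * ∑ k ∈ Finset.range (n + 1), (C α⁻¹ * X) ^ k

lemma eval_powerMean (α z : ℂ) (n : ℕ) :
    (powerMean α n).eval z = ((n : ℂ) + 1)⁻¹ * ∑ k ∈ Finset.range (n + 1), (α⁻¹ * z) ^ k := by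
  simp [powerMean, eval_finsetSum]

lemma norm_natCast_add_one_inv (n : ℕ) : ‖((n : ℂ) + 1)⁻¹‖ = 1 / ((n : ℝ) + 1) := by
  rw [norm_inv, one_div, ← Nat.cast_succ, Complex.norm_natCast, Nat.cast_succ]

lemma norm_eval_powerMean_le {α z : ℂ} (hα : α ∈ circ) (hz : z ∈ circ) (n : ℕ) :
    ‖(powerMean α n).eval z‖ ≤ 1 := by
  have hα' : ‖α‖ = 1 := hα
  have hz' : ‖z‖ = 1 := hz
  rw [eval_powerMean, norm_mul, norm_natCast_add_one_inv]
  have h1 : ‖∑ k ∈ Finset.range (n + 1), (α⁻¹ * z) ^ k‖ ≤ (n : ℝ) + 1 := by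
    refine (norm_sum_le _ _).trans ?_
    simp [hα', hz']
  rw [one_div_mul_eq_div]
  exact div_le_one_of_le₀ h1 (by positivity)

lemma tendsto_eval_powerMean {α z : ℂ} (hα : α ∈ circ) (hz : z ∈ circ) (h : z ≠ α) :
    Tendsto (fun n => (powerMean α n).eval z) atTop (𝓝 0) := by
  have hα' : ‖α‖ = 1 := hα
  have hz' : ‖z‖ = 1 := hz
  have hα0 : α ≠ 0 := by
    rintro rfl
    simp at hα'
  have hw : α⁻¹ * z ≠ 1 := fun h1 => h (by field_simp at h1; exact h1)
  -- The geometric sum is `(w ^ (n + 1) - 1) / (w - 1)` with `w = z / α` of modulus `1`, so its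
  -- numerator is at most `2` in modulus.
  refine squeeze_zero_norm (a := fun n : ℕ => 1 / ((n : ℝ) + 1) * (2 / ‖α⁻¹ * z - 1‖))
    (fun n => ?_) ?_
  · rw [eval_powerMean, norm_mul, norm_natCast_add_one_inv, geom_sum_eq hw, norm_div]
    gcongr
    refine (norm_sub_le _ _).trans ?_
    simp [hα', hz']
    norm_num
  · simpa using tendsto_one_div_add_atTop_nhds_zero_nat.mul_const (2 / ‖α⁻¹ * z - 1‖)

/-- Dominated convergence: the means are bounded by `1` and tend to `0` off the single point `α`,
where they equal `1`. Hence evaluation at `α` is not continuous in the `L^p` norm. -/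
lemma tendsto_powerMean_smul_one (hp : p ≠ ⊤) {α : ℂ} (hα : α ∈ circ) :
    Tendsto (fun n => powerMean α n • (oneLp : LpT p)) atTop (𝓝 0) := by
  have hp0 : 0 < p.toReal :=
    ENNReal.toReal_pos (zero_lt_one.trans_le Fact.out).ne' hp
  rw [Lp.tendsto_Lp_iff_tendsto_eLpNorm']
  have e : ∀ n, eLpNorm (⇑(powerMean α n • (oneLp : LpT p)) - ⇑(0 : LpT p)) p arc =
      (∫⁻ x, ‖(powerMean α n).eval (zc x)‖ₑ ^ p.toReal ∂arc) ^ (1 / p.toReal) := by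
    intro n
    rw [← eLpNorm_eq_lintegral_rpow_enorm_toReal (zero_lt_one.trans_le Fact.out).ne' hp]
    refine eLpNorm_congr_ae ?_
    filter_upwards [coeFn_poly_smul_one (p := p) (powerMean α n), Lp.coeFn_zero ℂ p arc]
      with x h1 h2
    rw [Pi.sub_apply, h1, h2, Pi.zero_apply, sub_zero]
  simp only [e]
  have hlim : Tendsto (fun n => ∫⁻ x, ‖(powerMean α n).eval (zc x)‖ₑ ^ p.toReal ∂arc) atTop
      (𝓝 (∫⁻ _, 0 ∂arc)) := by
    refine tendsto_lintegral_of_dominated_convergence (fun _ => 1) (fun n => ?_) (fun n => ?_)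
      (by simp) ?_
    · exact ((continuous_eval_zc _).enorm.measurable).pow_const _
    · refine Eventually.of_forall fun x => ?_
      refine ENNReal.rpow_le_one ?_ hp0.le
      rw [← ofReal_norm, ENNReal.ofReal_le_one]
      exact norm_eval_powerMean_le hα (zc_mem_circ x) n
    · filter_upwards [ae_eval_ne_zero (X_sub_C_ne_zero α)] with x hx
      have hne : zc x ≠ α := by simpa [sub_eq_zero] using hx
      have h1 := (tendsto_eval_powerMean hα (zc_mem_circ x) hne).enorm
      rw [enorm_zero] at h1
      have h2 := (ENNReal.continuous_rpow_const (y := p.toReal)).tendsto 0 |>.comp h1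
      simpa [Function.comp_def, ENNReal.zero_rpow_of_pos hp0] using h2
  rw [lintegral_zero] at hlim
  have h2 := (ENNReal.continuous_rpow_const (y := 1 / p.toReal)).tendsto 0 |>.comp hlim
  simpa [Function.comp_def, ENNReal.zero_rpow_of_pos (inv_pos.2 hp0)] using h2

/-- The map `(g, c) ↦ (z - α) g + c` on `H^p × ℂ`. -/
def mulAddConst (p : ℝ≥0∞) [Fact (1 ≤ p)] (α : ℂ) : (Hardy p × ℂ) →L[ℂ] Hardy p :=
  ((aeval (R := ℂ) (shift (p := p)) (X - C α)) ∘L (Hardy p).subtypeL ∘L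
    ContinuousLinearMap.fst ℂ (Hardy p) ℂ +
      (ContinuousLinearMap.snd ℂ (Hardy p) ℂ).smulRight oneLp).codRestrict (Hardy p)
    fun u => Submodule.add_mem _ (poly_smul_mem_hardy (X - C α) u.1.2)
      (Submodule.smul_mem _ u.2 oneLp_mem_hardy)

lemma coe_mulAddConst (α : ℂ) (u : Hardy p × ℂ) :
    (mulAddConst p α u : LpT p) = (X - C α : ℂ[X]) • (u.1 : LpT p) + u.2 • oneLp := rfl

/-- If `α` is on the circle, not every function in `H^p` has a value `c` at `α` such that
`h - c` is divisible by `z - α` in `H^p`. -/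
lemma not_surjective_mulAddConst (hp : p ≠ ⊤) {α : ℂ} (hα : α ∈ circ) :
    ¬ Function.Surjective (mulAddConst p α) := by
  intro hsurj
  have hα' : ‖α‖ = 1 := hα
  have hα0 : α ≠ 0 := by
    rintro rfl
    simp at hα'
  have hinj : (mulAddConst p α).ker = ⊥ := by
    rw [LinearMap.ker_eq_bot']
    rintro ⟨g, c⟩ h0
    have h1 : (X - C α : ℂ[X]) • (g : LpT p) + c • oneLp = 0 := congrArg Subtype.val h0
    have hg : (g : LpT p) = 0 := by
      refine eq_zero_of_poly_smul_eq_poly hp (X_sub_C_ne_zero α) (fun z hz => ?_)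
        (r := C (-c)) ?_ g.2 ?_
      · rw [← root_X_sub_C.1 hz, hα']
      · rw [degree_X_sub_C]
        exact degree_C_le.trans_lt (by simp)
      · rw [C_smul, neg_smul]
        exact eq_neg_of_add_eq_zero_left h1
    rw [hg, smul_zero, zero_add, ← C_smul] at h1
    have hc := poly_smul_one_eq_zero h1
    exact Prod.ext (Subtype.ext hg) (C_eq_zero.1 hc)
  -- By the open mapping theorem the constant `c` would depend continuously on `(z - α) g + c`. For
  -- the power means it is always `1`, although they tend to `0`.
  set Φ := ContinuousLinearEquiv.ofBijective (mulAddConst p α) hinj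
    (LinearMap.range_eq_top.2 hsurj) with hΦ
  have heval : ∀ n, (powerMean α n).eval α = 1 := fun n => by
    rw [eval_powerMean, inv_mul_cancel₀ hα0]
    have : (n : ℂ) + 1 ≠ 0 := Nat.cast_add_one_ne_zero n
    simp [this]
  have hdvd : ∀ n, ∃ R : ℂ[X], powerMean α n = (X - C α) * R + 1 := fun n => by
    obtain ⟨R, hR⟩ := dvd_iff_isRoot.2
      (show (powerMean α n - 1).IsRoot α by simp [IsRoot, heval])
    exact ⟨R, by rw [← hR, sub_add_cancel]⟩
  choose R hR using hdvd
  let F : ℕ → Hardy p := fun n => ⟨powerMean α n • oneLp, poly_smul_one_mem_hardy _⟩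
  have hF : Tendsto F atTop (𝓝 0) := by
    rw [tendsto_subtype_rng]
    exact tendsto_powerMean_smul_one hp hα
  have hsymm : ∀ n, Φ.symm (F n) = (⟨R n • oneLp, poly_smul_one_mem_hardy _⟩, 1) := fun n => by
    rw [ContinuousLinearEquiv.symm_apply_eq]
    refine Subtype.ext ?_
    change powerMean α n • oneLp = (X - C α : ℂ[X]) • R n • (oneLp : LpT p) + (1 : ℂ) • oneLp
    rw [hR n]
    module
  have hlim := ((continuous_snd.comp Φ.symm.continuous).tendsto 0).comp hF
  simp only [Function.comp_def, hsymm, map_zero, Prod.snd_zero] at hlim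
  exact one_ne_zero (tendsto_nhds_unique tendsto_const_nhds hlim)

/-! ### Bijectivity -/

section Bijective

variable {ω : RatFunc ℂ} {a c d e : ℂ[X]}

/-- If `deg a < deg d`, then `g = e / c` is a nonzero kernel element, with `a` itself as remainder.
-/
lemma natDegree_le_of_injective (hp : p ≠ ⊤) (hc : c ≠ 0) (hd : d ≠ 0)
    (he : e ≠ 0) (hdr : ∀ z, d.IsRoot z → ‖z‖ ≤ 1) (hcr : ∀ z, c.IsRoot z → 1 < ‖z‖)
    (hω : ω = algebraMap ℂ[X] (RatFunc ℂ) (a * c) / algebraMap ℂ[X] (RatFunc ℂ) (d * e))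
    (hinj : ∀ g : Hardy p, (g, 0) ∈ toeplitzGraph p ω → g = 0) : d.natDegree ≤ a.natDegree := by
  by_contra! hlt
  obtain ⟨g, hg, hcg⟩ := exists_hardy_div_outer hp hc hcr (poly_smul_one_mem_hardy (p := p) e)
  have h0 := hinj ⟨g, hg⟩ (mem_toeplitzGraph_of_eq hp hd he hdr hω (r := a)
    (degree_lt_degree hlt) (by
      rw [mul_smul, hcg, Submodule.coe_zero]
      module))
  have hg0 : g = 0 := congrArg Subtype.val h0
  rw [hg0, smul_zero] at hcg
  exact he (poly_smul_one_eq_zero hcg.symm)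

/-- If `deg d < deg a`, the constant `1` has no preimage: it would give `a g' = d + r`, a nonzero
polynomial of degree `deg d`. -/
lemma natDegree_le_of_surjective (hp : p ≠ ⊤) (ha : a ≠ 0) (hd : d ≠ 0)
    (he : e ≠ 0) (har : ∀ z, a.IsRoot z → ‖z‖ ≤ 1)
    (hdr : ∀ z, d.IsRoot z → ‖z‖ ≤ 1) (her : ∀ z, e.IsRoot z → 1 < ‖z‖)
    (hω : ω = algebraMap ℂ[X] (RatFunc ℂ) (a * c) / algebraMap ℂ[X] (RatFunc ℂ) (d * e))
    (hsurj : ∀ h : Hardy p, ∃ g : Hardy p, (g, h) ∈ toeplitzGraph p ω) :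
    a.natDegree ≤ d.natDegree := by
  by_contra! hlt
  obtain ⟨g, hg⟩ := hsurj ⟨oneLp, oneLp_mem_hardy⟩
  obtain ⟨r, hr, h⟩ := exists_of_mem_toeplitzGraph hp hd he hdr her hω hg
  obtain ⟨g', hg', hgg'⟩ := exists_hardy_div_outer hp he her (poly_smul_mem_hardy c g.2)
  have h1 : a • g' = (d + r) • (oneLp : LpT p) := by
    refine poly_smul_left_cancel he ?_
    rw [smul_comm, hgg', ← mul_smul, h]
    module
  have hdeg : (d + r).degree = d.degree := degree_add_eq_left_of_degree_lt hr
  have h2 := eq_zero_of_poly_smul_eq_poly hp ha har (by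
    rw [hdeg]
    exact degree_lt_degree hlt) hg' h1
  rw [h2, smul_zero] at h1
  rw [poly_smul_one_eq_zero h1.symm, degree_zero] at hdeg
  exact hd (degree_eq_bot.1 hdeg.symm)

/-- At a root `α` of `N` the value `δ` of `d e` is nonzero. Expanding `d e` and `e r` around `α` in
`N g = d e h + e r` expresses `δ h` as a multiple of `z - α` plus a constant, for every `h`. -/
lemma not_isRoot_of_surjective (hp : p ≠ ⊤) (hd : d ≠ 0)
    (he : e ≠ 0) (hdr : ∀ z, d.IsRoot z → ‖z‖ ≤ 1) (her : ∀ z, e.IsRoot z → 1 < ‖z‖)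
    {N : ℂ[X]} (hcop : IsCoprime N (d * e))
    (hω : ω = algebraMap ℂ[X] (RatFunc ℂ) N / algebraMap ℂ[X] (RatFunc ℂ) (d * e))
    (hsurj : ∀ h : Hardy p, ∃ g : Hardy p, (g, h) ∈ toeplitzGraph p ω) :
    ∀ z ∈ circ, ¬ N.IsRoot z := by
  intro α hα hroot
  have hD : (d * e).eval α ≠ 0 := by
    intro h0
    obtain ⟨u, v, huv⟩ := hcop
    have := congrArg (eval α) huv
    rw [eval_add, eval_mul, eval_mul (q := d * e), h0, hroot.eq_zero] at this
    simp at this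
  have hdiv : ∀ q : ℂ[X], ∃ t : ℂ[X], q = (X - C α) * t + C (q.eval α) := fun q => by
    obtain ⟨t, ht⟩ := dvd_iff_isRoot.2 (show (q - C (q.eval α)).IsRoot α by simp [IsRoot])
    exact ⟨t, by rw [← ht, sub_add_cancel]⟩
  refine not_surjective_mulAddConst hp hα fun h => ?_
  obtain ⟨g, hg⟩ := hsurj h
  obtain ⟨r, -, hgh⟩ := exists_of_mem_toeplitzGraph hp hd he hdr her hω hg
  obtain ⟨N', rfl⟩ := dvd_iff_isRoot.2 hroot
  obtain ⟨D', hD'⟩ := hdiv (d * e)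
  obtain ⟨r', hr'⟩ := hdiv (e * r)
  set δ := (d * e).eval α with hδ
  set s := (e * r).eval α with hs
  refine ⟨(δ⁻¹ • ⟨N' • (g : LpT p) - D' • (h : LpT p) - r' • oneLp, ?_⟩, -(δ⁻¹ * s)), ?_⟩
  · exact Submodule.sub_mem _ (Submodule.sub_mem _ (poly_smul_mem_hardy _ g.2)
      (poly_smul_mem_hardy _ h.2)) (poly_smul_one_mem_hardy _)
  · refine Subtype.ext ?_
    rw [coe_mulAddConst]
    simp only [Submodule.coe_smul]
    rw [smul_comm, neg_smul, mul_smul, ← smul_neg, ← smul_add, inv_smul_eq_iff₀ hD]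
    rw [hD', hr', add_smul, add_smul, C_smul, C_smul] at hgh
    simp only [smul_sub, ← mul_smul]
    rw [hgh]
    abel

lemma surjective_of_natDegree_eq (hp : p ≠ ⊤) (ha : a ≠ 0) (hc : c ≠ 0) (hd : d ≠ 0)
    (he : e ≠ 0) (har : ∀ z, a.IsRoot z → z ∈ disc) (hcr : ∀ z, c.IsRoot z → 1 < ‖z‖)
    (hdr : ∀ z, d.IsRoot z → ‖z‖ ≤ 1)
    (hω : ω = algebraMap ℂ[X] (RatFunc ℂ) (a * c) / algebraMap ℂ[X] (RatFunc ℂ) (d * e))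
    (hdeg : a.natDegree = d.natDegree) (h : Hardy p) :
    ∃ g : Hardy p, (g, h) ∈ toeplitzGraph p ω := by
  obtain ⟨g', hg', r, hr, hdiv⟩ := exists_hardy_div hp ha har (poly_smul_mem_hardy d h.2)
  obtain ⟨g, hg, hgg'⟩ := exists_hardy_div_outer hp hc hcr (poly_smul_mem_hardy e hg')
  -- Here `d h = a g' + r` and `c g = e g'`, so `a c g = e (d h - r)`.
  refine ⟨⟨g, hg⟩, mem_toeplitzGraph_of_eq hp hd he hdr hω (r := -r) ?_ ?_⟩
  · rw [degree_neg, degree_eq_natDegree hd, ← hdeg]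
    rwa [degree_eq_natDegree ha] at hr
  · rw [mul_smul, hgg', mul_comm d e, mul_smul, hdiv]
    module

lemma injective_of_natDegree_eq (hp : p ≠ ⊤) (ha : a ≠ 0) (hc : c ≠ 0) (hd : d ≠ 0)
    (he : e ≠ 0) (har : ∀ z, a.IsRoot z → ‖z‖ ≤ 1)
    (hdr : ∀ z, d.IsRoot z → ‖z‖ ≤ 1) (her : ∀ z, e.IsRoot z → 1 < ‖z‖)
    (hω : ω = algebraMap ℂ[X] (RatFunc ℂ) (a * c) / algebraMap ℂ[X] (RatFunc ℂ) (d * e))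
    (hdeg : a.natDegree = d.natDegree) (g : Hardy p) (hg : (g, 0) ∈ toeplitzGraph p ω) :
    g = 0 := by
  obtain ⟨r, hr, h⟩ := exists_of_mem_toeplitzGraph hp hd he hdr her hω hg
  rw [Submodule.coe_zero, smul_zero, zero_add] at h
  obtain ⟨g', hg', hgg'⟩ := exists_hardy_div_outer hp he her (poly_smul_mem_hardy c g.2)
  have h1 : a • g' = r • (oneLp : LpT p) := by
    refine poly_smul_left_cancel he ?_
    rw [smul_comm, hgg', ← mul_smul, h, mul_smul]
  rw [degree_eq_natDegree hd, ← hdeg, ← degree_eq_natDegree ha] at hr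
  rw [eq_zero_of_poly_smul_eq_poly hp ha har hr hg' h1, smul_zero] at hgg'
  exact Subtype.ext (poly_smul_eq_zero hc hgg'.symm)

/-- The graph is the set where `N g - d e h` lies in the finite-dimensional, hence closed, space of
the `e r` with `deg r < deg d`. -/
lemma isClosed_toeplitzGraph (hp : p ≠ ⊤) {N : ℂ[X]} (hd : d ≠ 0)
    (he : e ≠ 0) (hdr : ∀ z, d.IsRoot z → ‖z‖ ≤ 1) (her : ∀ z, e.IsRoot z → 1 < ‖z‖)
    (hω : ω = algebraMap ℂ[X] (RatFunc ℂ) N / algebraMap ℂ[X] (RatFunc ℂ) (d * e)) :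
    IsClosed (toeplitzGraph p ω : Set (Hardy p × Hardy p)) := by
  set W : Submodule ℂ (LpT p) := (degreeLT ℂ d.natDegree).map
    ((LinearMap.toSpanSingleton ℂ[X] (LpT p) (e • oneLp)).restrictScalars ℂ) with hW
  have : FiniteDimensional ℂ (degreeLT ℂ d.natDegree) :=
    (degreeLTEquiv ℂ d.natDegree).symm.finiteDimensional
  have hWc : IsClosed (W : Set (LpT p)) := Submodule.closed_of_finiteDimensional W
  have heq : (toeplitzGraph p ω : Set (Hardy p × Hardy p)) =
      (fun u : Hardy p × Hardy p => N • (u.1 : LpT p) - (d * e) • (u.2 : LpT p)) ⁻¹' W := by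
    ext ⟨g, h⟩
    rw [SetLike.mem_coe, mem_toeplitzGraph_iff hp hd he hdr her hω]
    simp only [Set.mem_preimage, SetLike.mem_coe, hW, Submodule.mem_map, mem_degreeLT,
      LinearMap.coe_restrictScalars, LinearMap.toSpanSingleton_apply]
    rw [degree_eq_natDegree hd]
    refine exists_congr fun r => and_congr_right fun _ => ?_
    rw [eq_sub_iff_add_eq', eq_comm, ← mul_smul, mul_comm r e]
  rw [heq]
  refine hWc.preimage (Continuous.sub ?_ ?_)
  · exact (continuous_poly_smul N).comp (continuous_subtype_val.comp continuous_fst)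
  · exact (continuous_poly_smul (d * e)).comp (continuous_subtype_val.comp continuous_snd)

end Bijective

/-! ### Counting roots -/

open Classical in
/-- The number of roots of `q` in `S`, with multiplicities. -/
def rootCount (S : Set ℂ) (q : ℂ[X]) : ℕ := (q.roots.filter (· ∈ S)).card

lemma rootCount_mul (S : Set ℂ) {a b : ℂ[X]} (h : a * b ≠ 0) :
    rootCount S (a * b) = rootCount S a + rootCount S b := by
  rw [rootCount, roots_mul h, Multiset.filter_add, Multiset.card_add, rootCount, rootCount]

open Classical in
lemma rootCount_eq_natDegree {S : Set ℂ} {a : ℂ[X]} (ha : a ≠ 0)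
    (h : ∀ z, a.IsRoot z → z ∈ S) : rootCount S a = a.natDegree := by
  rw [rootCount, Multiset.filter_eq_self.2 fun z hz => h z ((mem_roots ha).1 hz)]
  exact (IsAlgClosed.splits a).natDegree_eq_card_roots.symm

open Classical in
lemma rootCount_eq_zero {S : Set ℂ} {a : ℂ[X]} (ha : a ≠ 0)
    (h : ∀ z, a.IsRoot z → z ∉ S) : rootCount S a = 0 := by
  rw [rootCount, Multiset.filter_eq_nil.2 fun z hz => h z ((mem_roots ha).1 hz),
    Multiset.card_zero]

lemma exists_eq_mul_disc_circ {q : ℂ[X]} (hq : q ≠ 0) :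
    ∃ a b c : ℂ[X], q = a * b * c ∧ (∀ z, a.IsRoot z → z ∈ disc) ∧
      (∀ z, b.IsRoot z → z ∈ circ) ∧ ∀ z, c.IsRoot z → 1 < ‖z‖ := by
  obtain ⟨a, q', rfl, ha, hq'⟩ := exists_eq_mul_of_roots disc hq
  obtain ⟨b, c, rfl, hb, hc⟩ := exists_eq_mul_of_roots circ (right_ne_zero_of_mul hq)
  refine ⟨a, b, c, by ring, ha, hb, fun z hz => ?_⟩
  exact lt_of_le_of_ne (not_lt.1 (hq' z (root_mul.2 (Or.inr hz)))) fun h => hc z hz h.symm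

lemma norm_le_of_root_mul {a b : ℂ[X]} (ha : ∀ z, a.IsRoot z → z ∈ disc)
    (hb : ∀ z, b.IsRoot z → z ∈ circ) (z : ℂ) (hz : (a * b).IsRoot z) : ‖z‖ ≤ 1 := by
  rcases root_mul.1 hz with h | h
  exacts [le_of_lt (ha z h), le_of_eq (hb z h)]

lemma rootCount_disc {a b c : ℂ[X]} (h : a * b * c ≠ 0) (ha : ∀ z, a.IsRoot z → z ∈ disc)
    (hb : ∀ z, b.IsRoot z → z ∈ circ) (hc : ∀ z, c.IsRoot z → 1 < ‖z‖) :
    rootCount disc (a * b * c) = a.natDegree := by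
  have h1 := left_ne_zero_of_mul h
  rw [rootCount_mul _ h, rootCount_mul _ h1,
    rootCount_eq_natDegree (S := disc) (left_ne_zero_of_mul h1) ha,
    rootCount_eq_zero (S := disc) (right_ne_zero_of_mul h1) fun z hz (hz' : ‖z‖ < 1) =>
      hz'.ne (hb z hz),
    rootCount_eq_zero (S := disc) (right_ne_zero_of_mul h) fun z hz (hz' : ‖z‖ < 1) =>
      hz'.not_gt (hc z hz),
    add_zero, add_zero]

lemma rootCount_circ {a b c : ℂ[X]} (h : a * b * c ≠ 0) (ha : ∀ z, a.IsRoot z → z ∈ disc)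
    (hb : ∀ z, b.IsRoot z → z ∈ circ) (hc : ∀ z, c.IsRoot z → 1 < ‖z‖) :
    rootCount circ (a * b * c) = b.natDegree := by
  have h1 := left_ne_zero_of_mul h
  rw [rootCount_mul _ h, rootCount_mul _ h1,
    rootCount_eq_zero (S := circ) (left_ne_zero_of_mul h1) fun z hz (hz' : ‖z‖ = 1) =>
      (show ‖z‖ < 1 from ha z hz).ne hz',
    rootCount_eq_natDegree (S := circ) (right_ne_zero_of_mul h1) hb,
    rootCount_eq_zero (S := circ) (right_ne_zero_of_mul h) fun z hz (hz' : ‖z‖ = 1) =>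
      (hc z hz).ne' hz',
    add_zero, zero_add]

/-! ### Invertibility and the inverse -/

lemma ne_zero_of_exists_pole {ω : RatFunc ℂ} (h : ∃ z ∈ circ, IsPoleOf ω z) : ω ≠ 0 := by
  rintro rfl
  obtain ⟨z, -, hz⟩ := h
  simp [IsPoleOf] at hz

/-- Invertibility of `T_ω` in terms of the degrees of the factors of numerator and denominator. -/
lemma bijective_toeplitz_iff_natDegree (hp : p ≠ ⊤) {ω : RatFunc ℂ} {a b c d e f : ℂ[X]}
    (hN0 : a * b * c ≠ 0) (hD0 : d * e * f ≠ 0)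
    (hω : ω = algebraMap ℂ[X] (RatFunc ℂ) (a * b * c) / algebraMap ℂ[X] (RatFunc ℂ) (d * e * f))
    (hcop : IsCoprime (a * b * c) (d * e * f))
    (ha : ∀ z, a.IsRoot z → z ∈ disc) (hb : ∀ z, b.IsRoot z → z ∈ circ)
    (hc : ∀ z, c.IsRoot z → 1 < ‖z‖) (hd : ∀ z, d.IsRoot z → z ∈ disc)
    (he : ∀ z, e.IsRoot z → z ∈ circ) (hf : ∀ z, f.IsRoot z → 1 < ‖z‖) :
    Function.Bijective (toeplitz p ω) ↔
      (∀ z ∈ circ, ¬ (a * b * c).IsRoot z) ∧ a.natDegree = d.natDegree + e.natDegree := by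
  have hab0 := left_ne_zero_of_mul hN0
  have hc0 := right_ne_zero_of_mul hN0
  have hde0 := left_ne_zero_of_mul hD0
  have hf0 := right_ne_zero_of_mul hD0
  have hab := norm_le_of_root_mul ha hb
  have hde := norm_le_of_root_mul hd he
  have hdeg : (d * e).natDegree = d.natDegree + e.natDegree :=
    natDegree_mul (left_ne_zero_of_mul hde0) (right_ne_zero_of_mul hde0)
  have hdegb : (∀ z ∈ circ, ¬ (a * b * c).IsRoot z) → b.natDegree = 0 := fun h => by
    by_contra hb0
    obtain ⟨z, hz⟩ := Complex.exists_root (natDegree_pos_iff_degree_pos.1 (Nat.pos_of_ne_zero hb0))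
    exact h z (hb z hz) (root_mul.2 (Or.inl (root_mul.2 (Or.inr hz))))
  have hdegab : (a * b).natDegree = a.natDegree + b.natDegree :=
    natDegree_mul (left_ne_zero_of_mul hab0) (right_ne_zero_of_mul hab0)
  rw [bijective_toeplitz_iff]
  constructor
  · rintro ⟨hsurj, hinj⟩
    have hroots := not_isRoot_of_surjective hp hde0 hf0 hde hf hcop hω hsurj
    refine ⟨hroots, ?_⟩
    have h1 := natDegree_le_of_injective hp hc0 hde0 hf0 hde hc hω hinj
    have h2 := natDegree_le_of_surjective hp hab0 hde0 hf0 hab hde hf hω hsurj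
    have h3 := hdegb hroots
    omega
  · rintro ⟨hroots, hdeg'⟩
    have h3 : (a * b).natDegree = (d * e).natDegree := by
      rw [hdegab, hdegb hroots, hdeg, add_zero, hdeg']
    refine ⟨surjective_of_natDegree_eq hp hab0 hc0 hde0 hf0 (fun z hz => ?_) hc hde hω h3,
      injective_of_natDegree_eq hp hab0 hc0 hde0 hf0 hab hde hf hω h3⟩
    rcases root_mul.1 hz with h | h
    · exact ha z h
    · exact absurd (root_mul.2 (Or.inl hz)) (hroots z (hb z h))

lemma ker_toeplitz {ω : RatFunc ℂ} (h : Function.Bijective (toeplitz p ω)) :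
    (toeplitz p ω).toFun.ker = ⊥ :=
  LinearMap.ker_eq_bot.2 h.1

lemma mem_graph_inverse_toeplitz {ω : RatFunc ℂ} (h : Function.Bijective (toeplitz p ω))
    {u v : Hardy p} : (u, v) ∈ (toeplitz p ω).inverse.graph ↔ (v, u) ∈ toeplitzGraph p ω := by
  rw [LinearPMap.inverse_graph (ker_toeplitz h), toeplitz_graph]
  constructor
  · rintro ⟨⟨x, y⟩, hxy, hxy'⟩
    obtain ⟨rfl, rfl⟩ := Prod.mk.inj hxy'
    exact hxy
  · intro h
    exact ⟨(v, u), h, rfl⟩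

lemma mem_graph_pcomp {E : Type*} [AddCommGroup E] [Module ℂ E] {B A : E →ₗ.[ℂ] E} {x z : E} :
    (x, z) ∈ (pcomp B A).graph ↔ ∃ y, (x, y) ∈ A.graph ∧ (y, z) ∈ B.graph := by
  simp only [LinearPMap.mem_graph_iff]
  constructor
  · rintro ⟨u, rfl, rfl⟩
    obtain ⟨h, hB⟩ := mem_pcomp_domain.1 u.2
    exact ⟨A ⟨u, h⟩, ⟨⟨u, h⟩, rfl, rfl⟩, ⟨A ⟨u, h⟩, hB⟩, rfl, rfl⟩
  · rintro ⟨y, ⟨u, rfl, rfl⟩, w, hw, rfl⟩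
    have hB : A u ∈ B.domain := hw ▸ w.2
    refine ⟨⟨u, mem_pcomp_domain.2 ⟨u.2, hB⟩⟩, rfl, ?_⟩
    have : w = ⟨A u, hB⟩ := Subtype.ext hw
    rw [this]
    rfl

lemma mem_graph_toPMap_top {E : Type*} [AddCommGroup E] [Module ℂ E] (S : E →ₗ[ℂ] E) {x y : E} :
    (x, y) ∈ (S.toPMap ⊤).graph ↔ S x = y := by
  rw [LinearPMap.mem_graph_iff]
  constructor
  · rintro ⟨u, rfl, rfl⟩
    rfl
  · rintro rfl
    exact ⟨⟨x, trivial⟩, rfl, rfl⟩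

/-- The closed graph theorem applies: the inverse is defined everywhere and its graph is the flipped
graph of `T_ω`. -/
lemma exists_continuous_inverse (hp : p ≠ ⊤) {ω : RatFunc ℂ}
    (h : Function.Bijective (toeplitz p ω)) :
    ∃ S : Hardy p →L[ℂ] Hardy p, (toeplitz p ω).inverse = S.toLinearMap.toPMap ⊤ := by
  obtain ⟨a, b, c, habc, ha, hb, hc⟩ := exists_eq_mul_disc_circ ω.denom_ne_zero
  have h0 : a * b * c ≠ 0 := habc ▸ ω.denom_ne_zero
  have hclosed := isClosed_toeplitzGraph (p := p) hp (left_ne_zero_of_mul h0)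
    (right_ne_zero_of_mul h0) (norm_le_of_root_mul ha hb) hc
    (N := ω.num) (by rw [← habc, RatFunc.num_div_denom])
  have hdom : (toeplitz p ω).inverse.domain = ⊤ := by
    rw [LinearPMap.inverse_domain]
    exact LinearMap.range_eq_top.2 h.2
  let S : Hardy p →ₗ[ℂ] Hardy p :=
    (toeplitz p ω).inverse.toFun ∘ₗ (LinearEquiv.ofTop _ hdom).symm.toLinearMap
  have hS : (toeplitz p ω).inverse = S.toPMap ⊤ := by
    refine LinearPMap.ext hdom fun x hx hx' => ?_
    rfl
  have hcont : Continuous S := by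
    refine S.continuous_of_isClosed_graph ?_
    have : (S.graph : Set (Hardy p × Hardy p)) = Prod.swap ⁻¹' (toeplitzGraph p ω) := by
      ext ⟨u, v⟩
      rw [SetLike.mem_coe, LinearMap.mem_graph_iff, Set.mem_preimage, Prod.swap_prod_mk,
        SetLike.mem_coe, ← mem_graph_inverse_toeplitz h, hS, mem_graph_toPMap_top]
      exact eq_comm
    rw [this]
    exact hclosed.preimage continuous_swap
  exact ⟨⟨S, hcont⟩, hS⟩

/-! ### The factorization -/

/-- The factors are `a / (d z^κ)`, `z^κ / e` and `b c / f`, with `κ = deg e`. The compensating pole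
at `0` lies in the disc, and `b` has no roots under `hroots`. -/
lemma exists_factorization {ω : RatFunc ℂ} {a b c d e f : ℂ[X]}
    (hD0 : d * e * f ≠ 0)
    (hω : ω = algebraMap ℂ[X] (RatFunc ℂ) (a * b * c) / algebraMap ℂ[X] (RatFunc ℂ) (d * e * f))
    (ha : ∀ z, a.IsRoot z → z ∈ disc) (hb : ∀ z, b.IsRoot z → z ∈ circ)
    (hc : ∀ z, c.IsRoot z → 1 < ‖z‖) (hd : ∀ z, d.IsRoot z → z ∈ disc)
    (he : ∀ z, e.IsRoot z → z ∈ circ) (hf : ∀ z, f.IsRoot z → 1 < ‖z‖)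
    (hroots : ∀ z ∈ circ, ¬ (a * b * c).IsRoot z) :
    ∃ (ωm : RatFunc ℂ) (q0 : ℂ[X]) (ωp : RatFunc ℂ),
      IsFactorization ω (e.natDegree : ℤ) ωm q0 ωp := by
  have hf0 := right_ne_zero_of_mul hD0
  have hde0 := left_ne_zero_of_mul hD0
  have he0 := right_ne_zero_of_mul hde0
  have hd0 := left_ne_zero_of_mul hde0
  have hdX : d * X ^ e.natDegree ≠ 0 := mul_ne_zero hd0 (pow_ne_zero _ X_ne_zero)
  refine ⟨algebraMap ℂ[X] (RatFunc ℂ) a / algebraMap ℂ[X] (RatFunc ℂ) (d * X ^ e.natDegree), e,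
    algebraMap ℂ[X] (RatFunc ℂ) (b * c) / algebraMap ℂ[X] (RatFunc ℂ) f, ?_, ?_, ?_, he0, rfl, he⟩
  · have h1 := RatFunc.algebraMap_ne_zero hd0
    have h2 := RatFunc.algebraMap_ne_zero he0
    have h3 := RatFunc.algebraMap_ne_zero hf0
    have h4 : (RatFunc.X : RatFunc ℂ) ≠ 0 := RatFunc.X_ne_zero
    rw [hω, zpow_natCast]
    simp only [map_mul, map_pow, RatFunc.algebraMap_X]
    field_simp
  · refine fun z hz => ⟨fun h => ?_, fun h => ?_⟩
    · exact (show ‖z‖ < 1 from ha z (IsRoot.dvd h (RatFunc.num_div_dvd _ hdX))).not_ge hz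
    · rcases root_mul.1 (IsRoot.dvd h (RatFunc.denom_div_dvd _ _)) with h | h
      · exact (show ‖z‖ < 1 from hd z h).not_ge hz
      · rw [IsRoot, eval_pow, eval_X] at h
        rw [eq_zero_of_pow_eq_zero h, norm_zero] at hz
        linarith
  · refine fun z hz => ⟨fun h => ?_, fun h => ?_⟩
    · rcases root_mul.1 (IsRoot.dvd h (RatFunc.num_div_dvd _ hf0)) with h | h
      · exact hroots z (hb z h) (root_mul.2 (Or.inl (root_mul.2 (Or.inr h))))
      · exact (hc z h).not_ge hz
    · exact (hf z (IsRoot.dvd h (RatFunc.denom_div_dvd _ _))).not_ge hz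

/-- Counting roots in the disc after clearing denominators gives `#zeroes + deg ωm.denom = deg
ωm.num + κ + #poles`, and `κ` is the difference of the two counts. -/
lemma IsFactorization.natDegree_num_eq {ω ωm ωp : RatFunc ℂ} {κ : ℤ} {q0 : ℂ[X]}
    (hF : IsFactorization ω κ ωm q0 ωp) (hω0 : ω ≠ 0)
    (hκ : κ = (numZeroes ω disc : ℤ) - (numPoles ω disc : ℤ)) :
    ωm.num.natDegree = ωm.denom.natDegree := by
  have hm0 : ωm ≠ 0 := by
    rintro rfl
    exact hω0 (by rw [hF.eq, zero_mul, zero_mul])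
  have hp0 : ωp ≠ 0 := by
    rintro rfl
    exact hω0 (by rw [hF.eq, mul_zero])
  have hmn := RatFunc.num_ne_zero hm0
  have hpn := RatFunc.num_ne_zero hp0
  have hmd := ωm.denom_ne_zero
  have hpd := ωp.denom_ne_zero
  have hX : (X ^ q0.natDegree : ℂ[X]) ≠ 0 := pow_ne_zero _ X_ne_zero
  have hD : ωm.denom * q0 * ωp.denom ≠ 0 := mul_ne_zero (mul_ne_zero hmd hF.ne_zero) hpd
  have hN : ωm.num * X ^ q0.natDegree * ωp.num ≠ 0 := mul_ne_zero (mul_ne_zero hmn hX) hpn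
  have heq : ω.num * (ωm.denom * q0 * ωp.denom) =
      ωm.num * X ^ q0.natDegree * ωp.num * ω.denom := by
    rw [RatFunc.num_mul_eq_mul_denom_iff hD, hF.eq, ← hF.degree, zpow_natCast]
    nth_rw 1 [← RatFunc.num_div_denom ωm, ← RatFunc.num_div_denom ωp]
    simp only [map_mul, map_pow, RatFunc.algebraMap_X]
    have h1 := RatFunc.algebraMap_ne_zero hmd
    have h2 := RatFunc.algebraMap_ne_zero hF.ne_zero
    have h3 := RatFunc.algebraMap_ne_zero hpd
    field_simp
  have hcount := congrArg (rootCount disc) heq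
  rw [rootCount_mul _ (mul_ne_zero (RatFunc.num_ne_zero hω0) hD),
    rootCount_mul _ (mul_ne_zero hN ω.denom_ne_zero), rootCount_mul _ hD, rootCount_mul _ hN,
    rootCount_mul _ (left_ne_zero_of_mul hD), rootCount_mul _ (left_ne_zero_of_mul hN),
    rootCount_eq_natDegree (S := disc) hmd fun z hz => not_le.1 fun h => (hF.minus z h).2 hz,
    rootCount_eq_natDegree (S := disc) hmn fun z hz => not_le.1 fun h => (hF.minus z h).1 hz,
    rootCount_eq_zero (S := disc) hF.ne_zero fun z hz (h : ‖z‖ < 1) => h.ne (hF.roots z hz),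
    rootCount_eq_zero (S := disc) hpd fun z hz (h : ‖z‖ < 1) => (hF.plus z h.le).2 hz,
    rootCount_eq_zero (S := disc) hpn fun z hz (h : ‖z‖ < 1) => (hF.plus z h.le).1 hz,
    rootCount_eq_natDegree (S := disc) hX fun z hz => by
      rw [IsRoot, eval_pow, eval_X] at hz
      simp [disc, eq_zero_of_pow_eq_zero hz], natDegree_X_pow] at hcount
  have h1 : numZeroes ω disc = rootCount disc ω.num := rfl
  have h2 : numPoles ω disc = rootCount disc ω.denom := rfl
  have h3 := hF.degree
  omega

/-- The product on the right is contained in the inverse of `T_ω` and is defined on all of `H^p`, so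
the two coincide. -/
lemma inverse_toeplitz_eq (hp : p ≠ ⊤) {ω ωm ωp : RatFunc ℂ} {κ : ℤ} {q0 : ℂ[X]}
    (hF : IsFactorization ω κ ωm q0 ωp) (hω0 : ω ≠ 0)
    (hdeg : ωm.num.natDegree = ωm.denom.natDegree)
    (hbij : Function.Bijective (toeplitz p ω)) :
    (toeplitz p ω).inverse = pcomp (toeplitz p ωp⁻¹)
      (pcomp (toeplitz p (algebraMap ℂ[X] (RatFunc ℂ) q0 / RatFunc.X ^ κ))
        (toeplitz p ωm⁻¹)) := by
  obtain rfl := hF.degree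
  have hm0 : ωm ≠ 0 := by
    rintro rfl
    exact hω0 (by rw [hF.eq, zero_mul, zero_mul])
  have hp0 : ωp ≠ 0 := by
    rintro rfl
    exact hω0 (by rw [hF.eq, mul_zero])
  have hA0 := RatFunc.num_ne_zero hm0
  have hE0 := RatFunc.num_ne_zero hp0
  have hB0 := ωm.denom_ne_zero
  have hG0 := ωp.denom_ne_zero
  have hX0 : (X ^ q0.natDegree : ℂ[X]) ≠ 0 := pow_ne_zero _ X_ne_zero
  have hωm : ωm = algebraMap ℂ[X] (RatFunc ℂ) ωm.num / algebraMap ℂ[X] (RatFunc ℂ) ωm.denom :=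
    (RatFunc.num_div_denom ωm).symm
  have hωp : ωp = algebraMap ℂ[X] (RatFunc ℂ) ωp.num / algebraMap ℂ[X] (RatFunc ℂ) ωp.denom :=
    (RatFunc.num_div_denom ωp).symm
  have hA : ∀ z, ωm.num.IsRoot z → z ∈ disc := fun z hz => not_le.1 fun h => (hF.minus z h).1 hz
  have hB : ∀ z, ωm.denom.IsRoot z → z ∈ disc := fun z hz => not_le.1 fun h => (hF.minus z h).2 hz
  have hE : ∀ z, ωp.num.IsRoot z → 1 < ‖z‖ := fun z hz => not_le.1 fun h => (hF.plus z h).1 hz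
  have hG : ∀ z, ωp.denom.IsRoot z → 1 < ‖z‖ := fun z hz => not_le.1 fun h => (hF.plus z h).2 hz
  have hX : ∀ z, (X ^ q0.natDegree : ℂ[X]).IsRoot z → z ∈ disc := fun z hz => by
    rw [IsRoot, eval_pow, eval_X] at hz
    simp [disc, eq_zero_of_pow_eq_zero hz]
  set A := ωm.num
  set B := ωm.denom
  set E := ωp.num
  set G := ωp.denom
  have h1 : ∀ z, (1 : ℂ[X]).IsRoot z → 1 < ‖z‖ := fun z hz => by simp [IsRoot] at hz
  have h1' : ∀ z, (1 : ℂ[X]).IsRoot z → ‖z‖ ≤ 1 := fun z hz => by simp [IsRoot] at hz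
  have hminus : ∀ {u v : Hardy p}, (u, v) ∈ toeplitzGraph p ωm⁻¹ ↔ ∃ r : ℂ[X],
      r.degree < A.degree ∧ B • (u : LpT p) = (A * 1) • (v : LpT p) + (1 * r) • oneLp :=
    mem_toeplitzGraph_iff hp hA0 one_ne_zero (fun z hz => le_of_lt (hA z hz)) h1
      (by rw [mul_one, hωm, inv_div])
  have hmid : ∀ {u v : Hardy p}, (u, v) ∈ toeplitzGraph p
      (algebraMap ℂ[X] (RatFunc ℂ) q0 / RatFunc.X ^ (q0.natDegree : ℤ)) ↔ ∃ r : ℂ[X],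
      r.degree < (X ^ q0.natDegree : ℂ[X]).degree ∧
        q0 • (u : LpT p) = (X ^ q0.natDegree * 1) • (v : LpT p) + (1 * r) • oneLp :=
    mem_toeplitzGraph_iff hp hX0 one_ne_zero (fun z hz => le_of_lt (hX z hz)) h1
      (by rw [mul_one, map_pow, RatFunc.algebraMap_X, zpow_natCast])
  have hplus : ∀ {u v : Hardy p}, (u, v) ∈ toeplitzGraph p ωp⁻¹ ↔ ∃ r : ℂ[X],
      r.degree < (1 : ℂ[X]).degree ∧
        G • (u : LpT p) = (1 * E) • (v : LpT p) + (E * r) • oneLp :=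
    mem_toeplitzGraph_iff hp one_ne_zero hE0 h1' hE (by rw [one_mul, hωp, inv_div])
  have hω : ω = algebraMap ℂ[X] (RatFunc ℂ) (A * X ^ q0.natDegree * E) /
      algebraMap ℂ[X] (RatFunc ℂ) (B * q0 * G) := by
    rw [hF.eq, hωm, hωp, zpow_natCast]
    simp only [map_mul, map_pow, RatFunc.algebraMap_X]
    have h1 := RatFunc.algebraMap_ne_zero hB0
    have h2 := RatFunc.algebraMap_ne_zero hF.ne_zero
    have h3 := RatFunc.algebraMap_ne_zero hG0
    field_simp
  have hdegAB : A.degree = B.degree := by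
    rw [degree_eq_natDegree hA0, degree_eq_natDegree hB0, hdeg]
  have hdegX : (X ^ q0.natDegree : ℂ[X]).degree = q0.degree := by
    rw [degree_X_pow, degree_eq_natDegree hF.ne_zero]
  have hchain : ∀ {h h₁ h₂ g : Hardy p}, (h, h₁) ∈ toeplitzGraph p ωm⁻¹ →
      (h₁, h₂) ∈ toeplitzGraph p
        (algebraMap ℂ[X] (RatFunc ℂ) q0 / RatFunc.X ^ (q0.natDegree : ℤ)) →
      (h₂, g) ∈ toeplitzGraph p ωp⁻¹ → (g, h) ∈ toeplitzGraph p ω := by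
    intro h h₁ h₂ g hm hi hpl
    obtain ⟨r₁, hr₁, e₁⟩ := hminus.1 hm
    obtain ⟨r₂, hr₂, e₂⟩ := hmid.1 hi
    obtain ⟨r₃, hr₃, e₃⟩ := hplus.1 hpl
    -- Since `ωp⁻¹` has no poles in the closed disc, its operator is plain multiplication, without
    -- remainder.
    have hr₃0 : r₃ = 0 := by
      rw [degree_one] at hr₃
      exact degree_eq_bot.1 (Nat.WithBot.lt_zero_iff.1 hr₃)
    subst hr₃0
    -- Eliminating `h₁` and `h₂` leaves `-(q₀ r₁ + A r₂)` as remainder. Its degree is below `deg (B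
    -- q₀)` because `deg A = deg B` and `deg z^κ = deg q₀`.
    refine mem_toeplitzGraph_of_eq hp (mul_ne_zero hB0 hF.ne_zero) hG0
      (norm_le_of_root_mul hB hF.roots) hω (r := -(q0 * r₁ + A * r₂)) ?_ ?_
    · rw [degree_neg]
      refine (degree_add_le _ _).trans_lt (max_lt ?_ ?_)
      · rw [mul_comm B, degree_mul, degree_mul, ← hdegAB]
        exact WithBot.add_lt_add_left (degree_ne_bot.2 hF.ne_zero) hr₁
      · rw [degree_mul, degree_mul, ← hdegAB, ← hdegX]
        exact WithBot.add_lt_add_left (degree_ne_bot.2 hA0) hr₂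
    · linear_combination (norm := module)
        (-(A * X ^ q0.natDegree : ℂ[X])) • e₃ - (A * G) • e₂ - (q0 * G) • e₁
  refine LinearPMap.eq_of_eq_graph (Submodule.ext ?_)
  rintro ⟨h, g⟩
  rw [mem_graph_inverse_toeplitz hbij, mem_graph_pcomp]
  simp only [mem_graph_pcomp, toeplitz_graph]
  constructor
  · intro hgh
    -- Three divisions run the product on `h`; injectivity of `T_ω` identifies the result `g'` with
    -- `g`.
    obtain ⟨h₁, hh₁, r₁, hr₁, e₁⟩ := exists_hardy_div hp hA0 hA (poly_smul_mem_hardy B h.2)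
    obtain ⟨h₂, hh₂, r₂, hr₂, e₂⟩ := exists_hardy_div hp hX0 hX (poly_smul_mem_hardy q0 hh₁)
    obtain ⟨g', hg', e₃⟩ := exists_hardy_div_outer hp hE0 hE (poly_smul_mem_hardy G hh₂)
    have m₁ : (h, ⟨h₁, hh₁⟩) ∈ toeplitzGraph p ωm⁻¹ :=
      hminus.2 ⟨r₁, hr₁, by rw [mul_one, one_mul, e₁]⟩
    have m₂ := (hmid (u := ⟨h₁, hh₁⟩) (v := ⟨h₂, hh₂⟩)).2 ⟨r₂, hr₂, by
      rw [mul_one, one_mul, e₂]⟩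
    have m₃ : ((⟨h₂, hh₂⟩ : Hardy p), ⟨g', hg'⟩) ∈ toeplitzGraph p ωp⁻¹ :=
      hplus.2 ⟨0, by simp, by rw [one_mul, mul_zero, zero_smul, add_zero, e₃]⟩
    have hsub := (toeplitzGraph p ω).sub_mem hgh (hchain m₁ m₂ m₃)
    rw [Prod.mk_sub_mk, sub_self] at hsub
    rw [sub_eq_zero.1 (((bijective_toeplitz_iff ω).1 hbij).2 _ hsub)]
    exact ⟨_, ⟨_, m₁, m₂⟩, m₃⟩
  · rintro ⟨h₂, ⟨h₁, m₁, m₂⟩, m₃⟩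
    exact hchain m₁ m₂ m₃

end ToeplitzLike

end

theorem propositionP {p : ℝ≥0∞} [Fact (1 ≤ p)] (hp1 : 1 < p) (hp : p ≠ ⊤)
    (ω : RatFunc ℂ) (hω : ∃ z ∈ ToeplitzLike.circ, ToeplitzLike.IsPoleOf ω z)
    (κ : ℤ) (hκ : κ = (ToeplitzLike.numZeroes ω ToeplitzLike.disc : ℤ) -
      (ToeplitzLike.numPoles ω ToeplitzLike.disc : ℤ)) :
    (Function.Bijective (ToeplitzLike.toeplitz p ω) ↔
      (∀ z ∈ ToeplitzLike.circ, ¬ ToeplitzLike.IsZeroOf ω z) ∧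
        κ = (ToeplitzLike.numPoles ω ToeplitzLike.circ : ℤ)) ∧
    (Function.Bijective (ToeplitzLike.toeplitz p ω) →
      (∃ S : ToeplitzLike.Hardy p →L[ℂ] ToeplitzLike.Hardy p,
        (ToeplitzLike.toeplitz p ω).inverse = S.toLinearMap.toPMap ⊤) ∧
      (∃ (ωm : RatFunc ℂ) (q0 : ℂ[X]) (ωp : RatFunc ℂ),
        ToeplitzLike.IsFactorization ω κ ωm q0 ωp) ∧
      ∀ (ωm : RatFunc ℂ) (q0 : ℂ[X]) (ωp : RatFunc ℂ),
        ToeplitzLike.IsFactorization ω κ ωm q0 ωp →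
        (ToeplitzLike.toeplitz p ω).inverse =
          ToeplitzLike.pcomp (ToeplitzLike.toeplitz p ωp⁻¹)
            (ToeplitzLike.pcomp
              (ToeplitzLike.toeplitz p (algebraMap ℂ[X] (RatFunc ℂ) q0 / RatFunc.X ^ κ))
              (ToeplitzLike.toeplitz p ωm⁻¹))) := by
  have hω0 := ToeplitzLike.ne_zero_of_exists_pole hω
  obtain ⟨a, b, c, hN, ha, hb, hc⟩ :=
    ToeplitzLike.exists_eq_mul_disc_circ (RatFunc.num_ne_zero hω0)
  obtain ⟨d, e, f, hD, hd, he, hf⟩ := ToeplitzLike.exists_eq_mul_disc_circ ω.denom_ne_zero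
  have hN0 : a * b * c ≠ 0 := hN ▸ RatFunc.num_ne_zero hω0
  have hD0 : d * e * f ≠ 0 := hD ▸ ω.denom_ne_zero
  have hrep : ω = algebraMap ℂ[X] (RatFunc ℂ) (a * b * c) /
      algebraMap ℂ[X] (RatFunc ℂ) (d * e * f) := by
    rw [← hN, ← hD, RatFunc.num_div_denom]
  have hcop : IsCoprime (a * b * c) (d * e * f) := by
    rw [← hN, ← hD]
    exact ω.isCoprime_num_denom
  have hzero : ToeplitzLike.numZeroes ω ToeplitzLike.disc = a.natDegree := by
    rw [← ToeplitzLike.rootCount_disc hN0 ha hb hc, ← hN]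
    rfl
  have hpole : ToeplitzLike.numPoles ω ToeplitzLike.disc = d.natDegree := by
    rw [← ToeplitzLike.rootCount_disc hD0 hd he hf, ← hD]
    rfl
  have hpoleT : ToeplitzLike.numPoles ω ToeplitzLike.circ = e.natDegree := by
    rw [← ToeplitzLike.rootCount_circ hD0 hd he hf, ← hD]
    rfl
  have hiff := ToeplitzLike.bijective_toeplitz_iff_natDegree (p := p) hp hN0 hD0 hrep hcop
    ha hb hc hd he hf
  have hmain : Function.Bijective (ToeplitzLike.toeplitz p ω) ↔
      (∀ z ∈ ToeplitzLike.circ, ¬ ToeplitzLike.IsZeroOf ω z) ∧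
        κ = (ToeplitzLike.numPoles ω ToeplitzLike.circ : ℤ) := by
    simp only [ToeplitzLike.IsZeroOf]
    rw [hiff, hN, hpoleT, hκ, hzero, hpole]
    refine and_congr_right fun _ => ?_
    omega
  refine ⟨hmain, fun hbij => ⟨ToeplitzLike.exists_continuous_inverse hp hbij, ?_, ?_⟩⟩
  · rw [(hmain.1 hbij).2, hpoleT]
    exact ToeplitzLike.exists_factorization hD0 hrep ha hb hc hd he hf (hiff.1 hbij).1
  · intro ωm q0 ωp hF
    exact ToeplitzLike.inverse_toeplitz_eq hp hF hω0 (hF.natDegree_num_eq hω0 hκ) hbij
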